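/- **Setting.** The Bernoulli channel $B$ takes an input $x\in[0,1]$ and outputs $1$ with probability $x$ and $0$ with probability $1-x$; $B^n(\cdot\,|u)$ is the output law on $\{0,1\}^n$ of $n$ independent uses with input $u\in[0,1]^n$. An $(n,N,\lambda_1,\lambda_2)$ deterministic identification (DI) code over $B$, with $\lambda_1,\lambda_2>0$, is a family of pairs $(u_i,\mathcal D_i)$, $i=1,\dots,N$, with $u_i\in[0,1]^n$ and $\mathcal D_i\subseteq\{0,1\}^n$, such that $B^n(\mathcal D_i|u_i)\ge 1-\lambda_1$ and $B^n(\mathcal D_j|u_i)\le\lambda_2$ for all $i\ne j$. Its linearithmic rate is $\log N/(n\log n)$. All logarithms are natural, and $\lambda=\lambda(n)=2\exp(-2(\log n)^2)$. **$L$-layer codes.** Write $\Pi_w$ for the orthogonal projection onto $\mathbb R w$. Points $u_1,\dots,u_M$ on the sphere of radius $r$ about the origin are $d$-angle-dense if $\|\Pi_{u_k}u_j-u_k\|\ge d$ for all $j\ne k$. For $L\ge1$ and $0<\delta<1$, an $L$-layer code of block length $n$ with parameter $\delta$ is obtained as follows. 1. *Primitive code book.* There are numbers $N_1,\dots,N_L$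 and, for each $\ell\le L$ and each string $s_1,\dots,s_\ell$ with $1\le s_i\le N_i$, a vector $v_{s_1\dots s_\ell}\in\mathbb R^n$, such that, for every prefix $s_1,\dots,s_{\ell-1}$, the vectors $v_{s_1\dots s_{\ell-1}j}$, $j=1,\dots,N_\ell$, lie on the sphere of radius $r_\ell=n^{(1-\delta)/2^\ell}$ about the origin, are $d$-angle-dense with $d=3\log n$, and are orthogonal to $v_{s_1},v_{s_1s_2},\dots,v_{s_1\dots s_{\ell-1}}$. Put $N_P=\prod_{\ell=1}^L N_\ell$. 2. *Rotation and expurgation.* For a rotation $U\in SO(n)$ put $o_\emptyset=(\tfrac12,\dots,\tfrac12)$ and $o_{s_1\dots s_\ell}=o_\emptyset+\sum_{i=1}^{\ell}Uv_{s_1\dots s_i}$. The messages are the strings $s=s_1\dots s_L$ with $o_s\in[0,1]^n$, the code word of $s$ is $o_s$, and $N$ is the number of messages. 3. *Decoders.* The decoding region of $s$ is $\mathcal D_s=\bigcap_{\ell=1}^L\mathcal D_s^{(\ell)}$, where $\mathcal D_s^{(\ell)}$ is the set of the $y\in\{0,1\}^n$ whose orthogonal projection onto the affine line $o_{s_1\dots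 s_{\ell-1}}+\mathbb R\,Uv_{s_1\dots s_\ell}$ is at distance at most $\log n$ from $o_{s_1\dots s_\ell}$. **Theorem.** (i) There is an absolute constant $c>0$ such that for all $L\ge1$ and $0<\delta<1$ there is a constant $C$ (depending on $L$ and $\delta$) such that, for all sufficiently large $n$, there is an $L$-layer code with parameter $\delta$ that is an $(n,N,L\lambda,\lambda)$ DI code over $B$, with $$N\ge N_P\bigl(1-2n\,e^{-cn^\delta/8}\bigr),\qquad \frac{\log N}{n\log n}\ \ge\ \frac12\sum_{\ell=1}^L\frac{1-\delta}{2^\ell}-C\,\frac{\log\log n}{\log n}.$$ (ii) Consequently the rates come arbitrarily close to $\frac12$: for every $\varepsilon>0$ there are $L_0$ and $\delta_0>0$ such that for all $L\ge L_0$ and $0<\delta<\delta_0$, for all sufficiently large $n$, there is an $L$-layer code with parameter $\delta$ that is an $(n,N,L\lambda,\lambda)$ DI code over $B$ with $\log N/(n\log n)\ge\frac12-\varepsilon$. (iii) The linearithmic rate $\frac12$ is achieved with these error bounds: for every fixed $L\ge1$ one has $L\lambda(n),\lambda(n)\to0$, and there are $(n,N^{(n)},L\lambda,\lambda)$ DI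 codes over $B$ for all $n$ (not necessarily $L$-layer codes for this same $L$) with $\log N^{(n)}/(n\log n)\to\frac12$ as $n\to\infty$. -/

import Mathlib

open MeasureTheory ProbabilityTheory Filter Topology

/-! ### Deterministic identification (DI) codes over a memoryless channel -/

/-- The output law of `n` independent uses of the channel `W` on the input sequence `u`. -/
noncomputable def blockOutput {X Y : Type*} [MeasurableSpace X] [MeasurableSpace Y]
    (W : Kernel X Y) {n : ℕ} (u : Fin n → X) : Measure (Fin n → Y) :=
  Measure.pi fun t => W (u t)

/-- The pairs `(u i, D i)`, `i : M`, form a DI code of block length `n` with missed identification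
error at most `ε₁` and false identification error at most `ε₂` over the channel `W`. -/
structure IsDICode {X Y : Type*} [MeasurableSpace X] [MeasurableSpace Y]
    (W : Kernel X Y) {n : ℕ} {M : Type*} (u : M → Fin n → X) (D : M → Set (Fin n → Y))
    (ε₁ ε₂ : ℝ) : Prop where
  pos₁ : 0 < ε₁
  pos₂ : 0 < ε₂
  measurableSet : ∀ i, MeasurableSet (D i)
  missed : ∀ i, 1 - ε₁ ≤ (blockOutput W (u i)).real (D i)
  falseId : ∀ i j, i ≠ j → (blockOutput W (u i)).real (D j) ≤ ε₂

/-- There is an `(n, N, ε₁, ε₂)` DI code over the channel `W`. -/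
def HasDICode {X Y : Type*} [MeasurableSpace X] [MeasurableSpace Y]
    (W : Kernel X Y) (n N : ℕ) (ε₁ ε₂ : ℝ) : Prop :=
  ∃ (u : Fin N → Fin n → X) (D : Fin N → Set (Fin n → Y)), IsDICode W u D ε₁ ε₂

/-- The linearithmic rate `log N / (n log n)`. -/
noncomputable def linRate (n N : ℕ) : ℝ := Real.log N / (n * Real.log n)

/-- The linearithmic rate `R` is achieved over `W` by a sequence of reliable
`(n, N n, ε₁ n, ε₂ n)` DI codes, with the prescribed vanishing errors. -/
def AchievesLinRate {X Y : Type*} [MeasurableSpace X] [MeasurableSpace Y]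
    (W : Kernel X Y) (ε₁ ε₂ : ℕ → ℝ) (R : ℝ) : Prop :=
  Tendsto ε₁ atTop (𝓝 0) ∧ Tendsto ε₂ atTop (𝓝 0) ∧
    ∃ N : ℕ → ℕ, (∀ n, HasDICode W n (N n) (ε₁ n) (ε₂ n)) ∧
      Tendsto (fun n => linRate n (N n)) atTop (𝓝 R)

/-! ### The Bernoulli channel -/

/-- The Bernoulli channel: on input `x ∈ [0,1]` it outputs `true` (the symbol `1`) with
probability `x` and `false` (the symbol `0`) with probability `1 - x`. -/
noncomputable def bernoulliChannel : Kernel unitInterval Bool where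
  toFun x := bernoulliMeasure true false x
  measurable' := by
    have h1 : Measurable fun x : unitInterval => (unitInterval.toNNReal x : ENNReal) := by
      have : Continuous unitInterval.toNNReal := by fun_prop
      exact this.measurable.coe_nnreal_ennreal
    have h2 : Measurable fun x : unitInterval =>
        (unitInterval.toNNReal (unitInterval.symm x) : ENNReal) :=
      h1.comp unitInterval.continuous_symm.measurable
    classical
    refine Measure.measurable_of_measurable_coe _ fun s hs => ?_
    simp only [bernoulliMeasure_apply _ hs]
    by_cases ht : true ∈ s <;> by_cases hf : false ∈ s <;> simp [ht, hf, h1, h2]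

instance : IsMarkovKernel bernoulliChannel where
  isProbabilityMeasure x := inferInstanceAs (IsProbabilityMeasure (bernoulliMeasure true false x))

/-- `λ = 2 exp (-2 (log n)²)`. -/
noncomputable def lam (n : ℕ) : ℝ := 2 * Real.exp (-2 * Real.log n ^ 2)

/-! ### The layered construction -/

/-- The centre `(1/2, …, 1/2)` of the unit cube. -/
noncomputable def cubeCentre (n : ℕ) : EuclideanSpace ℝ (Fin n) := WithLp.toLp 2 fun _ => 1 / 2

/-- A channel output, as a vertex of the unit cube. -/
noncomputable def vertex {n : ℕ} (y : Fin n → Bool) : EuclideanSpace ℝ (Fin n) :=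
  WithLp.toLp 2 fun t => if y t then 1 else 0

/-- The points `u j` lie on the sphere of radius `r` about the origin, and for distinct indices
`j`, `k` the orthogonal projection of `u j` onto the line `ℝ u k` is at distance at least `d`
from `u k`. -/
def IsAngleDense {n : ℕ} (d r : ℝ) {ι : Type*} (u : ι → EuclideanSpace ℝ (Fin n)) : Prop :=
  (∀ j, ‖u j‖ = r) ∧
    ∀ j k, j ≠ k → d ≤ ‖(Submodule.span ℝ {u k}).starProjection (u j) - u k‖

/-- An `L`-layer primitive code book in `ℝⁿ` with parameter `δ`, together with a rotation. Layers
are numbered from `0`, so that layer `ℓ` has radius `n ^ ((1 - δ) / 2 ^ (ℓ + 1))`. A word is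
addressed by a string `s`, with `s ℓ < num ℓ`, and `vec s ℓ` is the vector leading from the point
`s 0, …, s (ℓ - 1)` of the construction to the point `s 0, …, s ℓ`. -/
structure LayeredCode (n L : ℕ) (δ : ℝ) where
  num : Fin L → ℕ
  vec : ((ℓ : Fin L) → Fin (num ℓ)) → Fin L → EuclideanSpace ℝ (Fin n)
  /-- the vector of layer `ℓ` depends on the first entries of the string only -/
  vec_congr : ∀ s s' ℓ, (∀ i ≤ ℓ, s i = s' i) → vec s ℓ = vec s' ℓ
  /-- each layer lies in the orthogonal complement of the vectors of the preceding layers -/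
  vec_orthogonal : ∀ s i j, i ≠ j → inner ℝ (vec s i) (vec s j) = 0
  /-- around each point of a layer, the points of the next layer form an angle-dense set -/
  vec_angleDense : ∀ s ℓ, IsAngleDense (3 * Real.log n) ((n : ℝ) ^ ((1 - δ) / 2 ^ (ℓ.val + 1)))
    fun j : Fin (num ℓ) => vec (Function.update s ℓ j) ℓ
  rot : Matrix.specialOrthogonalGroup (Fin n) ℝ

namespace LayeredCode

variable {n L : ℕ} {δ : ℝ} (K : LayeredCode n L δ)

/-- The vectors of the rotated construction. -/
noncomputable def dir (s : (ℓ : Fin L) → Fin (K.num ℓ)) (ℓ : Fin L) : EuclideanSpace ℝ (Fin n) :=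
  Matrix.toEuclideanLin K.rot.1 (K.vec s ℓ)

/-- The point reached from the centre of the cube after the first `k` layers, in the rotated
construction. -/
noncomputable def point (s : (ℓ : Fin L) → Fin (K.num ℓ)) (k : ℕ) : EuclideanSpace ℝ (Fin n) :=
  cubeCentre n + ∑ i : Fin L with i.val < k, K.dir s i

/-- The messages: the strings whose rotated word, a point of the last layer, lies in the unit
cube. -/
def Message : Type :=
  {s : (ℓ : Fin L) → Fin (K.num ℓ) // ∀ t, K.point s L t ∈ Set.Icc (0 : ℝ) 1}

/-- The code word of a message, as a channel input. -/
noncomputable def word (m : K.Message) : Fin n → unitInterval :=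
  fun t => ⟨K.point m.1 L t, m.2 t⟩

/-- Orthogonal projection onto the line through the points of the layers `ℓ - 1` and `ℓ` of the
string `s`. -/
noncomputable def lineProj (s : (ℓ : Fin L) → Fin (K.num ℓ)) (ℓ : Fin L)
    (y : EuclideanSpace ℝ (Fin n)) : EuclideanSpace ℝ (Fin n) :=
  K.point s ℓ.val +
    (Submodule.span ℝ {K.dir s ℓ}).starProjection (y - K.point s ℓ.val)

/-- The decoding region of a message at layer `ℓ`. -/
def layerDecoder (m : K.Message) (ℓ : Fin L) : Set (Fin n → Bool) :=
  {y | ‖K.lineProj m.1 ℓ (vertex y) - K.point m.1 (ℓ.val + 1)‖ ≤ Real.log n}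

/-- The decoding region of a message. -/
def decoder (m : K.Message) : Set (Fin n → Bool) := ⋂ ℓ, K.layerDecoder m ℓ

/-- The size of the primitive code book. -/
def primitiveSize : ℕ := ∏ ℓ, K.num ℓ

/-- The number of words that lie in the unit cube after the rotation. -/
noncomputable def size : ℕ := Nat.card K.Message

end LayeredCode

/-! ### Hoeffding's inequality for the output of the Bernoulli channel -/

/-! Everything probabilistic is Hoeffding's inequality for `∑ b j * (Y j - u j)`: when `b` is a unit
vector, a deviation of `log n` in one direction has probability at most `exp (-2 (log n)²)`.

Size. On a sphere of radius `r`, the projection of `u` onto the line of `v` is at distance `‖u - v‖²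
/ (2r)` from `v`. Angle-density `d` therefore asks only for separation `√(2rd)`, and a greedy
packing in dimension about `n` yields about `(r / (8d)) ^ (n/2)` points
(`exists_isAngleDense_orthogonal`). A layer of radius `n ^ α` thus contributes rate about `α / 2`.
Removing the at most `L` preceding directions costs only lower-order terms, so the rates add up to
`1/2 * ∑ (1 - δ) / 2 ^ ℓ`.

Decoding. At the first layer where two strings differ, let `f`, `f'` be the true and the tested
vector and `g` the sum of the later true vectors. The mean of the test misses its target by `x = ‖f
- f'‖² / (2r) ≥ 3 log n`, up to the interference `⟪f', g⟫ / r`. Since `g ⟂ f`, this equals `⟪f' - f,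
g⟫ / r`. Each radius squared is the preceding radius, so `‖g‖² ≤ 2r` and the interference is at most
`2√x`, negligible against `x` (`add_one_le_sub_inner_div`). This is why the exponents halve.

Rotation. A Hartley matrix times random signs replaces a Haar-random rotation. Its entries have size
`O(1/√n)`, so Hoeffding keeps each coordinate of a word of squared norm `O(n ^ (1 - δ))` below `1/2`
except with probability `2 exp (-c n ^ δ / 8)`. Averaging over the signs gives one good choice
(`exists_rotation_card_le`).

For the exact rate `1/2`, codes with more and more layers are used. Raising the tolerance to `log n
+ 1` removes the factor `L` from the first error, and capping the size at `n ^ (n / 2)` makes a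
converse unnecessary. -/

instance isProbabilityMeasure_blockOutput {n : ℕ} (u : Fin n → unitInterval) :
    IsProbabilityMeasure (blockOutput bernoulliChannel u) := by
  unfold blockOutput; infer_instance

theorem integral_bernoulliChannel (x : unitInterval) (f : Bool → ℝ) :
    ∫ y, f y ∂bernoulliChannel x = x * f true + (1 - x) * f false := by
  change ∫ y, f y ∂bernoulliMeasure true false x = _
  rw [integral_bernoulliMeasure]
  simp

theorem hasSubgaussianMGF_bernoulliChannel (x : unitInterval) (b : ℝ) :
    HasSubgaussianMGF (fun y : Bool => b * ((if y then 1 else 0) - (x : ℝ)))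
      (b ^ 2 / 4).toNNReal (bernoulliChannel x) := by
  have h := (hasSubgaussianMGF_of_mem_Icc (μ := bernoulliChannel x) (a := 0) (b := 1)
    (X := fun y : Bool => if y then (1 : ℝ) else 0) (by fun_prop)
    (ae_of_all _ fun y => by cases y <;> simp)).const_mul b
  rw [integral_bernoulliChannel] at h
  have hc : (b ^ 2 / 4).toNNReal = ⟨b ^ 2, sq_nonneg b⟩ * (‖(1 : ℝ) - 0‖₊ / 2) ^ 2 := by
    apply NNReal.eq
    rw [Real.coe_toNNReal _ (by positivity)]
    change _ = b ^ 2 * _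
    simp
    ring
  rw [hc]
  simpa using h

/-- Each summand lives on an interval of length `|b j|`, hence is subgaussian with variance proxy `b
j ^ 2 / 4`; by independence the proxies add. -/
theorem blockOutput_real_le_sum_le_exp {n : ℕ} (u : Fin n → unitInterval) (b : Fin n → ℝ)
    {S t : ℝ} (hS : 0 < S) (hb : ∑ j, b j ^ 2 ≤ S) (ht : 0 ≤ t) :
    (blockOutput bernoulliChannel u).real
      {y | t ≤ ∑ j, b j * ((if y j then 1 else 0) - (u j : ℝ))} ≤ Real.exp (-2 * t ^ 2 / S) := by
  have hind : iIndepFun (fun j (y : Fin n → Bool) =>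
      b j * ((if y j then 1 else 0) - (u j : ℝ))) (blockOutput bernoulliChannel u) :=
    iIndepFun_pi (μ := fun t => bernoulliChannel (u t))
      (X := fun j (y : Bool) => b j * ((if y then 1 else 0) - (u j : ℝ)))
      fun j => (measurable_of_finite _).aemeasurable
  have hsub : ∀ j ∈ Finset.univ, HasSubgaussianMGF (fun y : Fin n → Bool =>
      b j * ((if y j then 1 else 0) - (u j : ℝ))) (b j ^ 2 / 4).toNNReal
      (blockOutput bernoulliChannel u) := by
    intro j _
    refine HasSubgaussianMGF.of_map (Y := fun y : Fin n → Bool => y j)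
      (X := fun y : Bool => b j * ((if y then 1 else 0) - (u j : ℝ)))
      (measurable_pi_apply j).aemeasurable ?_
    unfold blockOutput
    rw [(measurePreserving_eval (fun t => bernoulliChannel (u t)) j).map_eq]
    exact hasSubgaussianMGF_bernoulliChannel _ _
  have hsum := HasSubgaussianMGF.sum_of_iIndepFun hind hsub
  have hle : (∑ j, (b j ^ 2 / 4).toNNReal : NNReal) ≤ (S / 4).toNNReal := by
    rw [← Real.toNNReal_sum_of_nonneg fun j _ => by positivity, ← Finset.sum_div]
    gcongr
  have h : HasSubgaussianMGF (fun y : Fin n → Bool =>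
      ∑ j, b j * ((if y j then 1 else 0) - (u j : ℝ))) (S / 4).toNNReal
      (blockOutput bernoulliChannel u) :=
    ⟨hsum.1, fun t => (hsum.2 t).trans (Real.exp_le_exp.2 (by gcongr))⟩
  refine (h.measure_ge_le ht).trans_eq ?_
  rw [Real.coe_toNNReal _ (by positivity)]
  congr 1
  field_simp
  ring

theorem blockOutput_real_le_abs_sum_le_exp {n : ℕ} (u : Fin n → unitInterval) (b : Fin n → ℝ)
    {S t : ℝ} (hS : 0 < S) (hb : ∑ j, b j ^ 2 ≤ S) (ht : 0 ≤ t) :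
    (blockOutput bernoulliChannel u).real
      {y | t ≤ |∑ j, b j * ((if y j then 1 else 0) - (u j : ℝ))|} ≤
        2 * Real.exp (-2 * t ^ 2 / S) := by
  have h1 := blockOutput_real_le_sum_le_exp u b hS hb ht
  have h2 := blockOutput_real_le_sum_le_exp u (-b) hS (by simpa using hb) ht
  have hsub : {y : Fin n → Bool | t ≤ |∑ j, b j * ((if y j then 1 else 0) - (u j : ℝ))|} ⊆
      {y | t ≤ ∑ j, b j * ((if y j then 1 else 0) - (u j : ℝ))} ∪
      {y | t ≤ ∑ j, (-b) j * ((if y j then 1 else 0) - (u j : ℝ))} := by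
    intro y hy
    simp only [Set.mem_ofPred_eq] at hy
    rcases le_abs.1 hy with h | h
    · exact Or.inl h
    · right
      simpa [Finset.sum_neg_distrib] using h
  refine (measureReal_mono hsub).trans ((measureReal_union_le _ _).trans ?_)
  linarith

/-! ### The Hartley matrix -/

/-- A geometric sum in an `n`-th root of unity, which is `1` exactly when `n ∣ k`. -/
theorem sum_exp_two_pi_mul {n : ℕ} (hn : n ≠ 0) (k : ℤ) :
    ∑ j : Fin n, Complex.exp (((2 * Real.pi * k / n * (j : ℕ) : ℝ) : ℂ) * Complex.I) =
      if (n : ℤ) ∣ k then (n : ℂ) else 0 := by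
  have hn' : (n : ℂ) ≠ 0 := by exact_mod_cast hn
  set z : ℂ := Complex.exp (2 * Real.pi * Complex.I * (k / n)) with hz
  have hpow : ∀ j : ℕ, Complex.exp (((2 * Real.pi * k / n * j : ℝ) : ℂ) * Complex.I) = z ^ j := by
    intro j
    rw [hz, ← Complex.exp_nat_mul]
    congr 1
    push_cast
    ring
  have hz1 : z = 1 ↔ (n : ℤ) ∣ k := by
    rw [hz, Complex.exp_eq_one_iff]
    constructor
    · rintro ⟨m, hm⟩
      refine ⟨m, ?_⟩
      have h2 : (2 * Real.pi * Complex.I : ℂ) ≠ 0 := Complex.two_pi_I_ne_zero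
      rw [mul_comm (m : ℂ)] at hm
      have h3 := mul_left_cancel₀ h2 hm
      rw [div_eq_iff hn'] at h3
      rw [mul_comm]
      exact_mod_cast h3
    · rintro ⟨m, rfl⟩
      refine ⟨m, ?_⟩
      push_cast
      field_simp
  simp_rw [hpow]
  rw [Fin.sum_univ_eq_sum_range (fun j => z ^ j)]
  split_ifs with h
  · simp [hz1.2 h]
  · have h1 : z ≠ 1 := fun h' => h (hz1.1 h')
    rw [geom_sum_eq h1]
    have : z ^ n = 1 := by
      rw [hz, ← Complex.exp_nat_mul, Complex.exp_eq_one_iff]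
      exact ⟨k, by field_simp⟩
    simp [this]

theorem sum_cos_two_pi_mul {n : ℕ} (hn : n ≠ 0) (k : ℤ) :
    ∑ j : Fin n, Real.cos (2 * Real.pi * k / n * (j : ℕ)) = if (n : ℤ) ∣ k then (n : ℝ) else 0 := by
  have h := congrArg Complex.re (sum_exp_two_pi_mul hn k)
  simp only [Complex.re_sum, Complex.exp_ofReal_mul_I_re] at h
  rw [h]
  split_ifs <;> simp

theorem sum_sin_two_pi_mul {n : ℕ} (hn : n ≠ 0) (k : ℤ) :
    ∑ j : Fin n, Real.sin (2 * Real.pi * k / n * (j : ℕ)) = 0 := by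
  have h := congrArg Complex.im (sum_exp_two_pi_mul hn k)
  simp only [Complex.im_sum, Complex.exp_ofReal_mul_I_im] at h
  rw [h]
  split_ifs <;> simp

/-- The matrix of the discrete Hartley transform. -/
noncomputable def hartleyMatrix (n : ℕ) : Matrix (Fin n) (Fin n) ℝ :=
  Matrix.of fun t j => (Real.cos (2 * Real.pi * ((t : ℕ) : ℤ) / n * (j : ℕ)) +
    Real.sin (2 * Real.pi * ((t : ℕ) : ℤ) / n * (j : ℕ))) / √n

/-- With `cas = cos + sin`, one has `cas a * cas b = cos (a - b) + sin (a + b)`. The sines sum to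
zero, and the cosines do unless `n` divides `t - s`, which forces `t = s` since `|t - s| < n`. -/
theorem hartleyMatrix_mul_transpose (n : ℕ) :
    hartleyMatrix n * (hartleyMatrix n).transpose = 1 := by
  ext t s
  have hn : n ≠ 0 := by rintro rfl; exact t.elim0
  have hn' : (0 : ℝ) < n := by positivity
  have hsq : √(n : ℝ) * √(n : ℝ) = n := Real.mul_self_sqrt hn'.le
  have hterm : ∀ j : Fin n, hartleyMatrix n t j * (hartleyMatrix n).transpose j s =
      (Real.cos (2 * Real.pi * (((t : ℕ) - (s : ℕ) : ℤ) : ℝ) / n * (j : ℕ)) +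
        Real.sin (2 * Real.pi * (((t : ℕ) + (s : ℕ) : ℤ) : ℝ) / n * (j : ℕ))) / n := by
    intro j
    have h1 : 2 * Real.pi * (((t : ℕ) - (s : ℕ) : ℤ) : ℝ) / n * (j : ℕ) =
        2 * Real.pi * ((t : ℕ) : ℤ) / n * (j : ℕ) - 2 * Real.pi * ((s : ℕ) : ℤ) / n * (j : ℕ) := by
      push_cast; ring
    have h2 : 2 * Real.pi * (((t : ℕ) + (s : ℕ) : ℤ) : ℝ) / n * (j : ℕ) =
        2 * Real.pi * ((t : ℕ) : ℤ) / n * (j : ℕ) + 2 * Real.pi * ((s : ℕ) : ℤ) / n * (j : ℕ) := by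
      push_cast; ring
    rw [h1, h2, Real.cos_sub, Real.sin_add, Matrix.transpose_apply]
    simp only [hartleyMatrix, Matrix.of_apply]
    rw [div_mul_div_comm, hsq]
    ring
  rw [Matrix.mul_apply, Finset.sum_congr rfl fun j _ => hterm j, ← Finset.sum_div,
    Finset.sum_add_distrib, sum_cos_two_pi_mul hn, sum_sin_two_pi_mul hn, Matrix.one_apply]
  by_cases hts : t = s
  · simp [hts, hn'.ne']
  · have : ¬ (n : ℤ) ∣ ((t : ℕ) - (s : ℕ) : ℤ) := by
      intro hd
      have := Int.eq_zero_of_abs_lt_dvd hd (by rw [abs_lt]; omega)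
      exact hts (Fin.ext (by omega))
    simp [hts, this]

/-- Flatness of the rows is what makes random signs as effective as a random rotation. -/
theorem hartleyMatrix_sq_le {n : ℕ} (t j : Fin n) : hartleyMatrix n t j ^ 2 ≤ 2 / n := by
  simp only [hartleyMatrix, Matrix.of_apply]
  rw [div_pow, Real.sq_sqrt (by positivity)]
  gcongr
  set x := 2 * Real.pi * ((t : ℕ) : ℤ) / n * (j : ℕ)
  nlinarith [Real.sin_sq_add_cos_sq x, sq_nonneg (Real.cos x - Real.sin x)]

/-! ### Rotation and expurgation -/

/-- A diagonal matrix of signs. -/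
def signMatrix {n : ℕ} (y : Fin n → Bool) : Matrix (Fin n) (Fin n) ℝ :=
  Matrix.diagonal fun j => if y j then 1 else -1

theorem signMatrix_mul_transpose {n : ℕ} (y : Fin n → Bool) :
    signMatrix y * (signMatrix y).transpose = 1 := by
  rw [signMatrix, Matrix.diagonal_transpose, Matrix.diagonal_mul_diagonal, ← Matrix.diagonal_one]
  congr 1
  ext j
  split_ifs <;> norm_num

/-- A matrix with orthonormal rows can be turned into a rotation without changing the absolute
values of the coordinates of its values. -/
theorem exists_specialOrthogonal_abs_mulVec_eq {n : ℕ} (A : Matrix (Fin n) (Fin n) ℝ)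
    (hA : A * A.transpose = 1) :
    ∃ U : Matrix.specialOrthogonalGroup (Fin n) ℝ,
      ∀ (w : Fin n → ℝ) t, |(U.1.mulVec w) t| = |(A.mulVec w) t| := by
  have hdet : A.det * A.det = 1 := by
    have := congrArg Matrix.det hA
    rwa [Matrix.det_mul, Matrix.det_transpose, Matrix.det_one] at this
  -- In dimension `0` there is no coordinate to flip, but the determinant is already `1`. Otherwise
  -- coordinate `0` is multiplied by `det A = ±1`.
  rcases n with _ | n
  · refine ⟨⟨A, ?_⟩, fun _ _ => rfl⟩
    rw [Matrix.mem_specialOrthogonalGroup_iff, Matrix.mem_orthogonalGroup_iff]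
    exact ⟨hA, by simp⟩
  · let D : Matrix (Fin (n + 1)) (Fin (n + 1)) ℝ :=
      Matrix.diagonal fun j => if j = 0 then A.det else 1
    have hD : D * D.transpose = 1 := by
      simp only [D]
      rw [Matrix.diagonal_transpose, Matrix.diagonal_mul_diagonal, ← Matrix.diagonal_one]
      congr 1
      ext j
      split_ifs <;> simp [hdet]
    refine ⟨⟨D * A, ?_⟩, ?_⟩
    · rw [Matrix.mem_specialOrthogonalGroup_iff, Matrix.mem_orthogonalGroup_iff]
      constructor
      · change D * A * (D * A).transpose = 1
        rw [Matrix.transpose_mul, Matrix.mul_assoc, ← Matrix.mul_assoc A, hA, Matrix.one_mul, hD]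
      · rw [Matrix.det_mul, Matrix.det_diagonal, Fin.prod_univ_succ]
        simp [hdet]
    · intro w t
      simp only [D]
      rw [← Matrix.mulVec_mulVec, Matrix.mulVec_diagonal, abs_mul]
      have : |A.det| = 1 := by
        rcases mul_self_eq_one_iff.1 hdet with h | h <;> simp [h]
      split_ifs <;> simp [this]

/-- Uniform signs are `2 * (y j - 1/2)`, where `y` is the channel output at the constant input
`1/2`, so Hoeffding applies again, with weights of squared norm at most `4 * (2/n) * S`. -/
theorem blockOutput_real_half_le_abs_le {n : ℕ} (w : Fin n → ℝ) {S : ℝ} (hS : 0 < S)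
    (hw : ∑ j, w j ^ 2 ≤ S) (t : Fin n) :
    (blockOutput bernoulliChannel fun _ : Fin n => (⟨1 / 2, by norm_num, by norm_num⟩ : unitInterval)).real
      {y | 1 / 2 ≤ |((hartleyMatrix n * signMatrix y).mulVec w) t|} ≤
        2 * Real.exp (-(n / (16 * S))) := by
  have hn : (0 : ℝ) < n := by
    have : n ≠ 0 := by rintro rfl; exact t.elim0
    positivity
  have h := blockOutput_real_le_abs_sum_le_exp
    (fun _ : Fin n => (⟨1 / 2, by norm_num, by norm_num⟩ : unitInterval))
    (fun j => 2 * hartleyMatrix n t j * w j) (S := 8 * S / n) (t := 1 / 2) (by positivity) ?_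
    (by norm_num)
  · convert h using 3
    · ext y
      rw [← Matrix.mulVec_mulVec]
      have : (hartleyMatrix n).mulVec ((signMatrix y).mulVec w) t =
          ∑ j, 2 * hartleyMatrix n t j * w j * ((if y j then 1 else 0) - (1 / 2 : ℝ)) := by
        rw [Matrix.mulVec, dotProduct]
        refine Finset.sum_congr rfl fun j _ => ?_
        rw [signMatrix, Matrix.mulVec_diagonal]
        split_ifs <;> ring
      rw [this]
    · field_simp
      norm_num
  · calc ∑ j, (2 * hartleyMatrix n t j * w j) ^ 2 ≤ ∑ j, 8 / n * w j ^ 2 := by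
          refine Finset.sum_le_sum fun j _ => ?_
          have := mul_le_mul_of_nonneg_right (hartleyMatrix_sq_le t j) (sq_nonneg (w j))
          calc _ = 4 * (hartleyMatrix n t j ^ 2 * w j ^ 2) := by ring
            _ ≤ 4 * (2 / n * w j ^ 2) := by gcongr
            _ = _ := by ring
      _ = 8 / n * ∑ j, w j ^ 2 := by rw [Finset.mul_sum]
      _ ≤ 8 / n * S := by gcongr
      _ = _ := by ring

/-- Some rotation moves most of a finite family of vectors into the cube `[-1/2, 1/2]ⁿ`. -/
theorem exists_rotation_card_le {n : ℕ} {ι : Type*} [Fintype ι] (w : ι → Fin n → ℝ) {S : ℝ}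
    (hS : 0 < S) (hw : ∀ i, ∑ j, w i j ^ 2 ≤ S) :
    ∃ U : Matrix.specialOrthogonalGroup (Fin n) ℝ,
      Fintype.card ι * (1 - 2 * n * Real.exp (-(n / (16 * S)))) ≤
        Nat.card {i // ∀ t, |(U.1.mulVec (w i)) t| ≤ 1 / 2} := by
  classical
  set μ := blockOutput bernoulliChannel
    fun _ : Fin n => (⟨1 / 2, by norm_num, by norm_num⟩ : unitInterval)
  let E : ι → Fin n → Set (Fin n → Bool) := fun i t =>
    {y | 1 / 2 ≤ |((hartleyMatrix n * signMatrix y).mulVec (w i)) t|}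
  -- `f` counts bad pairs (vector, coordinate), hence bounds the number of vectors leaving the cube;
  -- some `y` does no worse than its mean.
  let f : (Fin n → Bool) → ℝ := fun y => ∑ i, ∑ t, (E i t).indicator (fun _ => (1 : ℝ)) y
  have hint : ∫ y, f y ∂μ ≤ Fintype.card ι * (2 * n * Real.exp (-(n / (16 * S)))) := by
    simp only [f]
    rw [integral_finsetSum _ fun _ _ => Integrable.of_finite]
    calc _ ≤ ∑ i : ι, ∑ t : Fin n, 2 * Real.exp (-(n / (16 * S))) := by
          refine Finset.sum_le_sum fun i _ => ?_
          rw [integral_finsetSum _ fun _ _ => Integrable.of_finite]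
          refine Finset.sum_le_sum fun t _ => ?_
          rw [integral_indicator_const _ (Set.toFinite _).measurableSet]
          rw [smul_eq_mul, mul_one]
          exact blockOutput_real_half_le_abs_le (w i) hS (hw i) t
      _ = _ := by
          simp only [Finset.sum_const, Finset.card_univ, Fintype.card_fin, nsmul_eq_mul]
          ring
  obtain ⟨y, hy⟩ := exists_le_integral (μ := μ) (f := f) Integrable.of_finite
  obtain ⟨U, hU⟩ := exists_specialOrthogonal_abs_mulVec_eq (hartleyMatrix n * signMatrix y) (by
    rw [Matrix.transpose_mul, Matrix.mul_assoc, ← Matrix.mul_assoc (signMatrix y),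
      signMatrix_mul_transpose, Matrix.one_mul, hartleyMatrix_mul_transpose])
  refine ⟨U, ?_⟩
  have hcount : (Fintype.card ι : ℝ) ≤ Nat.card {i // ∀ t, |(U.1.mulVec (w i)) t| ≤ 1 / 2} + f y := by
    rw [Nat.card_eq_fintype_card, Fintype.card_subtype, Finset.card_filter, Nat.cast_sum]
    simp only [f]
    rw [← Finset.sum_add_distrib, Fintype.card_eq_sum_ones, Nat.cast_sum]
    refine Finset.sum_le_sum fun i _ => ?_
    have h0 : ∀ t ∈ Finset.univ, 0 ≤ (E i t).indicator (fun _ => (1 : ℝ)) y :=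
      fun t _ => Set.indicator_nonneg (fun _ _ => zero_le_one) _
    by_cases h : ∀ t, |(U.1.mulVec (w i)) t| ≤ 1 / 2
    · simp only [h, implies_true, if_true]
      have := Finset.sum_nonneg h0
      push_cast
      linarith
    · rw [if_neg h]
      push Not at h
      obtain ⟨t, ht⟩ := h
      rw [hU] at ht
      have h1 := Finset.single_le_sum h0 (Finset.mem_univ t)
      rw [Set.indicator_of_mem (show y ∈ E i t from ht.le)] at h1
      push_cast
      linarith
  linarith

/-! ### Packing a sphere -/

theorem one_add_mul_pow_le_add_pow {r ρ : ℝ} (hr : 0 ≤ r) (hρ : 0 ≤ ρ) (m : ℕ) :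
    r ^ (m + 1) + (m + 1) * r ^ m * ρ ≤ (r + ρ) ^ (m + 1) := by
  induction m with
  | zero => simp
  | succ m ih =>
    rw [pow_succ (r + ρ)]
    have h := mul_le_mul_of_nonneg_right ih (add_nonneg hr hρ)
    refine le_trans ?_ h
    push_cast
    have : 0 ≤ (m + 1) * r ^ m * ρ ^ 2 := by positivity
    ring_nf at this ⊢
    linarith

section Packing

variable {V : Type*} [NormedAddCommGroup V] [InnerProductSpace ℝ V] [FiniteDimensional ℝ V]

/-- A finite set whose `ρ`-neighbourhood covers a sphere is large. -/
theorem pow_le_card_of_sphere_subset {r ρ : ℝ} (hρ : 0 < ρ) (hr : 2 * ρ ≤ r)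
    {k : ℕ} (hk : k + 2 ≤ Module.finrank ℝ V) (s : Finset V)
    (hs : ∀ z : V, ‖z‖ = r → ∃ x ∈ s, dist z x < ρ) : (r / (2 * ρ)) ^ k ≤ s.card := by
  borelize V
  have hr0 : 0 < r := by linarith
  have : Nontrivial V := Module.nontrivial_of_finrank_pos (R := ℝ) (by omega)
  obtain ⟨m, hm⟩ : ∃ m, Module.finrank ℝ V = m + 1 := ⟨Module.finrank ℝ V - 1, by omega⟩
  let μ : Measure V := volume
  have hω : 0 < μ.real (Metric.ball (0 : V) 1) :=
    ENNReal.toReal_pos (Metric.measure_ball_pos _ _ one_pos).ne' measure_ball_lt_top.ne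
  -- A point of the shell between `r` and `r + ρ` is within `ρ` of its radial projection to the
  -- sphere, hence within `2ρ` of `s`. Comparing volumes bounds `s.card` from below.
  have hcover : Metric.closedBall (0 : V) (r + ρ) ⊆
      Metric.closedBall 0 r ∪ ⋃ x ∈ s, Metric.closedBall x (2 * ρ) := by
    intro y hy
    rw [mem_closedBall_zero_iff] at hy
    rcases le_or_gt ‖y‖ r with h | h
    · exact Or.inl (mem_closedBall_zero_iff.2 h)
    right
    have hy0 : 0 < ‖y‖ := hr0.trans h
    obtain ⟨x, hx, hd⟩ := hs ((r / ‖y‖) • y) (by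
      rw [norm_smul, Real.norm_of_nonneg (by positivity)]
      field_simp)
    simp only [Set.mem_iUnion]
    refine ⟨x, hx, ?_⟩
    rw [Metric.mem_closedBall]
    have h1 : dist y ((r / ‖y‖) • y) ≤ ρ := by
      have : y - (r / ‖y‖) • y = (1 - r / ‖y‖) • y := by rw [sub_smul, one_smul]
      rw [dist_eq_norm, this, norm_smul, Real.norm_of_nonneg (by
        rw [sub_nonneg, div_le_one hy0]; exact h.le)]
      have : (1 - r / ‖y‖) * ‖y‖ = ‖y‖ - r := by field_simp
      linarith
    linarith [dist_triangle y ((r / ‖y‖) • y) x]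
  have hvol : (r + ρ) ^ (m + 1) ≤ r ^ (m + 1) + s.card * (2 * ρ) ^ (m + 1) := by
    have hle : μ.real (Metric.closedBall (0 : V) (r + ρ)) ≤
        μ.real (Metric.closedBall (0 : V) r) + ∑ x ∈ s, μ.real (Metric.closedBall x (2 * ρ)) := by
      refine (measureReal_mono hcover ?_).trans ((measureReal_union_le _ _).trans ?_)
      · refine (measure_union_lt_top measure_closedBall_lt_top ?_).ne
        exact (measure_biUnion_lt_top s.finite_toSet fun x _ => measure_closedBall_lt_top)
      · gcongr
        exact measureReal_biUnion_finset_le _ _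
    rw [Measure.addHaar_real_closedBall _ _ (by positivity),
      Measure.addHaar_real_closedBall _ _ hr0.le] at hle
    simp_rw [Measure.addHaar_real_closedBall μ _ (show 0 ≤ 2 * ρ by positivity)] at hle
    rw [Finset.sum_const, nsmul_eq_mul, hm, ← mul_assoc, ← add_mul] at hle
    exact le_of_mul_le_mul_right hle hω
  have h1 := one_add_mul_pow_le_add_pow hr0.le hρ.le m
  have h2 : (m + 1) * r ^ m * ρ ≤ s.card * (2 * ρ) ^ (m + 1) := by linarith
  have hm1 : (1 : ℝ) ≤ m := by
    have : 1 ≤ m := by omega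
    exact_mod_cast this
  -- The factor `m + 1 ≥ 2` from the shell volume absorbs one factor `2`.
  have h3 : (2 * ρ) * r ^ m ≤ s.card * (2 * ρ) ^ (m + 1) := by
    refine le_trans ?_ h2
    have : 0 ≤ r ^ m * ρ := by positivity
    nlinarith
  have h4 : (r / (2 * ρ)) ^ m ≤ s.card := by
    rw [div_pow, div_le_iff₀ (by positivity)]
    rw [pow_succ, ← mul_assoc, mul_comm (2 * ρ)] at h3
    exact le_of_mul_le_mul_right h3 (by positivity)
  refine le_trans (pow_le_pow_right₀ ?_ (by omega)) h4
  rwa [le_div_iff₀ (by positivity), one_mul]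

/-- Greedy choice: while the set is smaller than the covering bound, some point of the sphere is at
distance at least `ρ` from all of it. -/
theorem exists_finset_sphere_separated {r ρ : ℝ} (hρ : 0 < ρ) (hr : 2 * ρ ≤ r)
    {k : ℕ} (hk : k + 2 ≤ Module.finrank ℝ V) (N : ℕ) (hN : N ≤ ⌈(r / (2 * ρ)) ^ k⌉₊) :
    ∃ s : Finset V, s.card = N ∧ (∀ x ∈ s, ‖x‖ = r) ∧
      ∀ x ∈ s, ∀ y ∈ s, x ≠ y → ρ ≤ dist x y := by
  classical
  induction N with
  | zero => exact ⟨∅, by simp⟩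
  | succ N ih =>
    obtain ⟨s, hcard, hs, hsep⟩ := ih (by omega)
    by_cases h : ∀ z : V, ‖z‖ = r → ∃ x ∈ s, dist z x < ρ
    · have := Nat.ceil_le.2 (pow_le_card_of_sphere_subset hρ hr hk s h)
      omega
    push Not at h
    obtain ⟨z, hz, hzs⟩ := h
    have hzn : z ∉ s := fun hz' => by
      have := hzs z hz'
      rw [dist_self] at this
      linarith
    refine ⟨insert z s, by rw [Finset.card_insert_of_notMem hzn, hcard], ?_, ?_⟩
    · intro x hx
      rcases Finset.mem_insert.1 hx with rfl | hx
      · exact hz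
      · exact hs x hx
    · intro x hx y hy hxy
      rcases Finset.mem_insert.1 hx with rfl | hxs <;> rcases Finset.mem_insert.1 hy with rfl | hys
      · exact absurd rfl hxy
      · exact hzs y hys
      · rw [dist_comm]
        exact hzs x hxs
      · exact hsep x hxs y hys hxy

end Packing

theorem norm_starProjection_span_singleton_sub {V : Type*} [NormedAddCommGroup V]
    [InnerProductSpace ℝ V] {v : V} (hv : v ≠ 0) (x : V) :
    ‖(Submodule.span ℝ {v}).starProjection x - v‖ = |inner ℝ v x / ‖v‖ - ‖v‖| := by
  rw [Submodule.starProjection_singleton]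
  have hv' : 0 < ‖v‖ := norm_pos_iff.2 hv
  have : ((inner ℝ v x : ℝ) / ((‖v‖ : ℝ) ^ 2 : ℝ)) • v - v =
      ((inner ℝ v x : ℝ) / ‖v‖ ^ 2 - 1) • v := by rw [sub_smul, one_smul]
  simp only [RCLike.ofReal_real_eq_id, id]
  rw [this, norm_smul, Real.norm_eq_abs]
  have habs : |(inner ℝ v x : ℝ) / ‖v‖ ^ 2 - 1| * ‖v‖ = |((inner ℝ v x : ℝ) / ‖v‖ ^ 2 - 1) * ‖v‖| := by
    rw [abs_mul, abs_norm]
  rw [habs]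
  congr 1
  field_simp

/-- On a common sphere, sufficiently separated points are angle-dense. -/
theorem le_norm_starProjection_sub {V : Type*} [NormedAddCommGroup V] [InnerProductSpace ℝ V]
    {u v : V} {r d : ℝ} (hr : 0 < r) (hu : ‖u‖ = r) (hv : ‖v‖ = r)
    (h : 2 * r * d ≤ ‖u - v‖ ^ 2) : d ≤ ‖(Submodule.span ℝ {v}).starProjection u - v‖ := by
  have hv0 : v ≠ 0 := by
    rintro rfl
    simp at hv
    linarith
  rw [norm_starProjection_span_singleton_sub hv0, hv]
  rw [norm_sub_sq_real, hu, hv, real_inner_comm] at h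
  have h1 : inner ℝ v u ≤ r * (r - d) := by nlinarith
  have h2 : inner ℝ v u / r ≤ r - d := by
    rw [div_le_iff₀ hr]
    linarith
  rw [abs_sub_comm]
  exact le_trans (by linarith) (le_abs_self _)

/-- Packing inside `Wᗮ` with separation `ρ = √(2rd)`, for which `(r / (2ρ))² = r / (8d)`. The family
is indexed by `ℕ` and its useful length does not depend on `W`, so all prefixes of a layer share one
alphabet. -/
theorem exists_isAngleDense_orthogonal {n : ℕ} {r d : ℝ} (hd : 0 < d) (hr : 8 * d ≤ r) {k : ℕ}
    (W : Submodule ℝ (EuclideanSpace ℝ (Fin n))) (hW : Module.finrank ℝ W + k + 2 ≤ n) :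
    ∃ u : ℕ → EuclideanSpace ℝ (Fin n), (∀ j, u j ∈ Wᗮ) ∧
      IsAngleDense d r fun j : Fin ⌈(r / (8 * d)) ^ ((k : ℝ) / 2)⌉₊ => u j := by
  have hr0 : 0 < r := by linarith
  set ρ := √(2 * r * d) with hρ
  have hρ0 : 0 < ρ := Real.sqrt_pos.2 (by positivity)
  have hρ2 : ρ ^ 2 = 2 * r * d := Real.sq_sqrt (by positivity)
  have hρr : 2 * ρ ≤ r := by
    refine abs_le_of_sq_le_sq' ?_ hr0.le |>.2
    nlinarith
  have hpow : (r / (8 * d)) ^ ((k : ℝ) / 2) = (r / (2 * ρ)) ^ k := by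
    have : r / (8 * d) = (r / (2 * ρ)) ^ (2 : ℝ) := by
      rw [Real.rpow_two, div_pow, mul_pow, hρ2]
      field_simp
      norm_num
    rw [this, ← Real.rpow_mul (by positivity), ← Real.rpow_natCast]
    congr 1
    ring
  have hfin : k + 2 ≤ Module.finrank ℝ Wᗮ := by
    have := W.finrank_add_finrank_orthogonal
    rw [finrank_euclideanSpace_fin] at this
    omega
  obtain ⟨s, hcard, hs, hsep⟩ := exists_finset_sphere_separated (V := Wᗮ) hρ0 hρr hfin _ le_rfl
  rw [hpow]
  set N := ⌈(r / (2 * ρ)) ^ k⌉₊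
  let e := s.equivFinOfCardEq hcard
  refine ⟨fun j => if h : j < N then ((e.symm ⟨j, h⟩ : Wᗮ) : EuclideanSpace ℝ (Fin n)) else 0,
    fun j => ?_, fun j => ?_, fun j l hjl => ?_⟩
  · dsimp only
    split_ifs
    · exact Submodule.coe_mem _
    · exact zero_mem _
  · simpa using hs _ (e.symm j).2
  · simp only [Fin.is_lt, dite_true, Fin.eta]
    refine le_norm_starProjection_sub hr0 (hs _ (e.symm j).2) (hs _ (e.symm l).2) ?_
    have hne : (e.symm j : Wᗮ) ≠ e.symm l := fun h => hjl (e.symm.injective (Subtype.ext h))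
    have := hsep _ (e.symm j).2 _ (e.symm l).2 hne
    rw [Subtype.dist_eq, dist_eq_norm] at this
    rw [← hρ2]
    gcongr

/-! ### Layered code books -/

/-- The span of the vectors chosen in the first `k` layers along the string `s`, when the layer `k`
over the span `W` of the preceding vectors is `P W k`. -/
def layerSpan {V : Type*} [AddCommGroup V] [Module ℝ V] (P : Submodule ℝ V → ℕ → ℕ → V)
    (s : ℕ → ℕ) : ℕ → Submodule ℝ V
  | 0 => ⊥
  | k + 1 => layerSpan P s k ⊔ Submodule.span ℝ {P (layerSpan P s k) k (s k)}

section LayerSpan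

variable {V : Type*} [AddCommGroup V] [Module ℝ V] (P : Submodule ℝ V → ℕ → ℕ → V)

theorem layerSpan_congr {s s' : ℕ → ℕ} {k : ℕ} (h : ∀ i < k, s i = s' i) :
    layerSpan P s k = layerSpan P s' k := by
  induction k with
  | zero => rfl
  | succ k ih =>
    rw [layerSpan, layerSpan, ih fun i hi => h i (by omega), h k (by omega)]

theorem layerSpan_mono (s : ℕ → ℕ) : Monotone (layerSpan P s) :=
  monotone_nat_of_le_succ fun _ => le_sup_left

theorem mem_layerSpan (s : ℕ → ℕ) {i j : ℕ} (hij : i < j) :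
    P (layerSpan P s i) i (s i) ∈ layerSpan P s j :=
  layerSpan_mono P s hij (le_sup_right (a := layerSpan P s i) (Submodule.mem_span_singleton_self _))

theorem finrank_layerSpan_le [Module.Finite ℝ V] (s : ℕ → ℕ) (k : ℕ) :
    Module.finrank ℝ (layerSpan P s k) ≤ k := by
  induction k with
  | zero => exact (finrank_bot ℝ V).le
  | succ k ih =>
    refine (Submodule.finrank_add_le_finrank_add_finrank _ _).trans (add_le_add ih ?_)
    exact (finrank_span_le_card _).trans (by simp)

end LayerSpan

/-- Choosing a packing `P W ℓ` once for every subspace `W` makes each vector a function of the span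
of its predecessors and its own letter, so dependence on prefixes only is automatic. -/
theorem exists_layered_vectors {n L k : ℕ} (hk : k + L + 1 ≤ n) {d : ℝ} (hd : 0 < d) (r : ℕ → ℝ)
    (hr : ∀ ℓ < L, 8 * d ≤ r ℓ) :
    ∃ vec : (ℕ → ℕ) → ℕ → EuclideanSpace ℝ (Fin n),
      (∀ s s' ℓ, (∀ i ≤ ℓ, s i = s' i) → vec s ℓ = vec s' ℓ) ∧
      (∀ s i j, i < j → j < L → inner ℝ (vec s i) (vec s j) = 0) ∧
      ∀ s, ∀ ℓ < L, IsAngleDense d (r ℓ) fun j : Fin ⌈(r ℓ / (8 * d)) ^ ((k : ℝ) / 2)⌉₊ =>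
        vec (Function.update s ℓ j) ℓ := by
  have hP : ∀ (W : Submodule ℝ (EuclideanSpace ℝ (Fin n))) (ℓ : ℕ),
      ∃ u : ℕ → EuclideanSpace ℝ (Fin n), ℓ < L → Module.finrank ℝ W ≤ ℓ → (∀ j, u j ∈ Wᗮ) ∧
        IsAngleDense d (r ℓ) fun j : Fin ⌈(r ℓ / (8 * d)) ^ ((k : ℝ) / 2)⌉₊ => u j := by
    intro W ℓ
    by_cases h : ℓ < L ∧ Module.finrank ℝ W ≤ ℓ
    · obtain ⟨u, hu⟩ := exists_isAngleDense_orthogonal hd (hr ℓ h.1) (k := k) W (by omega)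
      exact ⟨u, fun _ _ => hu⟩
    · exact ⟨0, fun h1 h2 => absurd ⟨h1, h2⟩ h⟩
  choose P hP using hP
  refine ⟨fun s ℓ => P (layerSpan P s ℓ) ℓ (s ℓ), fun s s' ℓ h => ?_, fun s i j hij hj => ?_,
    fun s ℓ hℓ => ?_⟩
  · dsimp only
    rw [layerSpan_congr P fun i hi => h i hi.le, h ℓ le_rfl]
  · exact Submodule.mem_orthogonal _ _ |>.1
      ((hP (layerSpan P s j) j hj (finrank_layerSpan_le P s j)).1 (s j)) _ (mem_layerSpan P s hij)
  · have h : ∀ j, layerSpan P (Function.update s ℓ j) ℓ = layerSpan P s ℓ := fun j =>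
      layerSpan_congr P fun i hi => Function.update_of_ne hi.ne _ _
    simp only [h, Function.update_self]
    exact (hP (layerSpan P s ℓ) ℓ hℓ (finrank_layerSpan_le P s ℓ)).2

namespace LayeredCode

/-- The string of natural numbers that extends a string of length `L`. -/
def extendString {L : ℕ} {num : Fin L → ℕ} (s : (ℓ : Fin L) → Fin (num ℓ)) (i : ℕ) : ℕ :=
  if h : i < L then s ⟨i, h⟩ else 0

theorem exists_num_eq {n L k : ℕ} {δ : ℝ} (hk : k + L + 1 ≤ n) (hn : 0 < Real.log n)
    (hr : ∀ ℓ < L, 24 * Real.log n ≤ (n : ℝ) ^ ((1 - δ) / 2 ^ (ℓ + 1))) :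
    ∃ K : LayeredCode n L δ, ∀ ℓ : Fin L, K.num ℓ =
      ⌈((n : ℝ) ^ ((1 - δ) / 2 ^ (ℓ.val + 1)) / (24 * Real.log n)) ^ ((k : ℝ) / 2)⌉₊ := by
  obtain ⟨vec, h1, h2, h3⟩ := exists_layered_vectors hk (d := 3 * Real.log n) (by positivity)
    (fun ℓ => (n : ℝ) ^ ((1 - δ) / 2 ^ (ℓ + 1))) fun ℓ hℓ => by
      have := hr ℓ hℓ
      linarith
  have h24 : 8 * (3 * Real.log n) = 24 * Real.log n := by ring
  rw [h24] at h3
  refine ⟨{ num := fun ℓ =>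
              ⌈((n : ℝ) ^ ((1 - δ) / 2 ^ (ℓ.val + 1)) / (24 * Real.log n)) ^ ((k : ℝ) / 2)⌉₊
            vec := fun s ℓ => vec (extendString s) ℓ
            vec_congr := ?_
            vec_orthogonal := ?_
            vec_angleDense := ?_
            rot := 1 }, fun _ => rfl⟩
  · intro s s' ℓ h
    refine h1 _ _ _ fun i hi => ?_
    have hiL : i < L := hi.trans_lt ℓ.2
    simp only [extendString, hiL, dite_true]
    rw [h ⟨i, hiL⟩ (Fin.le_def.2 hi)]
  · intro s i j hij
    rcases lt_or_gt_of_ne hij with h | h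
    · exact h2 _ _ _ h j.2
    · rw [real_inner_comm]
      exact h2 _ _ _ h i.2
  · intro s ℓ
    convert h3 (extendString s) ℓ ℓ.2 using 2 with j
    congr 1
    ext i
    by_cases hi : i = ℓ
    · subst hi
      simp [extendString]
    · rw [Function.update_of_ne hi, extendString, extendString]
      split_ifs with h
      · rw [Function.update_of_ne]
        intro h'
        exact hi (congrArg Fin.val h')
      · rfl

variable {n L : ℕ} {δ : ℝ} (K : LayeredCode n L δ)

/-- The layer radii. -/
theorem norm_vec (s : (ℓ : Fin L) → Fin (K.num ℓ)) (ℓ : Fin L) :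
    ‖K.vec s ℓ‖ = (n : ℝ) ^ ((1 - δ) / 2 ^ (ℓ.val + 1)) := by
  have := (K.vec_angleDense s ℓ).1 (s ℓ)
  simpa only [Function.update_eq_self] using this

theorem inner_rot (U : Matrix.specialOrthogonalGroup (Fin n) ℝ) (v w : EuclideanSpace ℝ (Fin n)) :
    inner ℝ (Matrix.toEuclideanLin U.1 v) (Matrix.toEuclideanLin U.1 w) = inner ℝ v w := by
  have hU : U.1.transpose * U.1 = 1 :=
    (Matrix.mem_orthogonalGroup_iff' _ _).1 (Matrix.mem_specialOrthogonalGroup_iff.1 U.2).1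
  rw [EuclideanSpace.inner_eq_star_dotProduct, EuclideanSpace.inner_eq_star_dotProduct]
  simp only [Matrix.ofLp_toLpLin, Matrix.toLin'_apply, star_trivial]
  rw [Matrix.dotProduct_mulVec, Matrix.vecMul_mulVec, hU, Matrix.vecMul_one]

theorem inner_dir (s s' : (ℓ : Fin L) → Fin (K.num ℓ)) (i j : Fin L) :
    inner ℝ (K.dir s i) (K.dir s' j) = inner ℝ (K.vec s i) (K.vec s' j) :=
  inner_rot _ _ _

theorem norm_dir (s : (ℓ : Fin L) → Fin (K.num ℓ)) (ℓ : Fin L) :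
    ‖K.dir s ℓ‖ = (n : ℝ) ^ ((1 - δ) / 2 ^ (ℓ.val + 1)) := by
  rw [← K.norm_vec s ℓ, @norm_eq_sqrt_real_inner _ _ _ (K.dir s ℓ), inner_dir,
    ← norm_eq_sqrt_real_inner]

theorem norm_sum_dir_sq (s : (ℓ : Fin L) → Fin (K.num ℓ)) (I : Finset (Fin L)) :
    ‖∑ i ∈ I, K.dir s i‖ ^ 2 = ∑ i ∈ I, ((n : ℝ) ^ ((1 - δ) / 2 ^ (i.val + 1))) ^ 2 := by
  rw [← real_inner_self_eq_norm_sq, sum_inner]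
  refine Finset.sum_congr rfl fun i hi => ?_
  rw [inner_sum, Finset.sum_eq_single i]
  · rw [real_inner_self_eq_norm_sq, norm_dir]
  · intro j _ hj
    rw [inner_dir, K.vec_orthogonal s i j hj.symm]
  · exact fun h => absurd hi h

theorem point_apply_length (s : (ℓ : Fin L) → Fin (K.num ℓ)) (t : Fin n) :
    K.point s L t = 1 / 2 + (K.rot.1.mulVec (∑ i, K.vec s i).ofLp) t := by
  have : K.point s L = cubeCentre n + Matrix.toEuclideanLin K.rot.1 (∑ i, K.vec s i) := by
    simp [point, dir, map_sum]
  rw [this, PiLp.add_apply, Matrix.ofLp_toLpLin, Matrix.toLin'_apply]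
  rfl

/-- A code book can be rotated so that few code words have to be expurgated. -/
theorem exists_num_eq_primitiveSize_le_size {S : ℝ} (hS : 0 < S)
    (hsum : ∑ ℓ : Fin L, ((n : ℝ) ^ ((1 - δ) / 2 ^ (ℓ.val + 1))) ^ 2 ≤ S) :
    ∃ K' : LayeredCode n L δ, K'.num = K.num ∧
      K'.primitiveSize * (1 - 2 * n * Real.exp (-(n / (16 * S)))) ≤ K'.size := by
  obtain ⟨U, hU⟩ := exists_rotation_card_le
    (fun (s : (ℓ : Fin L) → Fin (K.num ℓ)) => (∑ i, K.vec s i).ofLp) hS fun s => by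
      refine le_trans (le_of_eq ?_) hsum
      -- With the trivial rotation, `norm_sum_dir_sq` computes the norm of the unrotated sum.
      have h : ({ K with rot := 1 } : LayeredCode n L δ).dir = K.vec := by
        ext s ℓ : 2
        simp [dir]
      have := norm_sum_dir_sq ({ K with rot := 1 } : LayeredCode n L δ) s Finset.univ
      rw [h, EuclideanSpace.real_norm_sq_eq] at this
      exact this
  refine ⟨{ K with rot := U }, rfl, ?_⟩
  have hcard : Fintype.card ((ℓ : Fin L) → Fin (K.num ℓ)) =
      ({ K with rot := U } : LayeredCode n L δ).primitiveSize := by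
    simp [primitiveSize]
  rw [hcard] at hU
  refine hU.trans (le_of_eq ?_)
  rw [size]
  congr 1
  refine Nat.card_congr (Equiv.subtypeEquivRight fun s => forall_congr' fun t => ?_)
  have := point_apply_length ({ K with rot := U } : LayeredCode n L δ) s t
  rw [this, Set.mem_Icc, abs_le]
  constructor <;> rintro ⟨h1, h2⟩ <;> constructor <;> linarith

end LayeredCode

/-! ### Decoding -/

/-- The mean of the test statistic of a wrong message stays away from its nominal value, in spite of
the later layers `g`. -/
theorem add_one_le_sub_inner_div {V : Type*} [NormedAddCommGroup V] [InnerProductSpace ℝ V]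
    {f f' g : V} {r a : ℝ} (hr : 0 < r) (ha : 22 ≤ a) (hf : ‖f‖ = r) (hf' : ‖f'‖ = r)
    (hd : 3 * a ≤ ‖(Submodule.span ℝ {f'}).starProjection f - f'‖) (hfg : inner ℝ f g = 0)
    (hg : ‖g‖ ^ 2 ≤ 2 * r) : 2 * a + 1 ≤ r - inner ℝ f' (f + g) / r := by
  have hf'0 : f' ≠ 0 := by
    rintro rfl
    simp at hf'
    linarith
  rw [norm_starProjection_span_singleton_sub hf'0, hf'] at hd
  set x := r - inner ℝ f' f / r with hx
  have hle : inner ℝ f' f ≤ r * r := by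
    have := real_inner_le_norm f' f
    rwa [hf, hf'] at this
  have hx0 : 0 ≤ x := by
    rw [hx, sub_nonneg, div_le_iff₀ hr]
    exact hle
  have hdx : 3 * a ≤ x := by
    rwa [abs_sub_comm, abs_of_nonneg hx0] at hd
  have hinner : inner ℝ f' f = r * (r - x) := by
    rw [hx]
    field_simp
    ring
  have hdiff : ‖f' - f‖ ^ 2 = 2 * r * x := by
    rw [norm_sub_sq_real, hf, hf', hinner]
    ring
  have hig : inner ℝ f' g ≤ 2 * r * √x := by
    have h1 : inner ℝ f' g = inner ℝ (f' - f) g := by rw [inner_sub_left, hfg, sub_zero]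
    rw [h1]
    refine (real_inner_le_norm _ _).trans (abs_le_of_sq_le_sq' ?_ (by positivity)).2
    rw [mul_pow, mul_pow, hdiff, Real.sq_sqrt hx0]
    calc 2 * r * x * ‖g‖ ^ 2 ≤ 2 * r * x * (2 * r) := by gcongr
      _ = _ := by ring
  -- Here `a ≥ 22` enters: `x ≥ 66 > 64`. Hence `x - 2√x ≥ 3x/4 ≥ 9a/4 ≥ 2a + 1`.
  have hsq : 8 * √x ≤ x := by
    have h8 : 8 ≤ √x := Real.le_sqrt_of_sq_le (by linarith)
    nlinarith [Real.mul_self_sqrt hx0]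
  have hdiv : inner ℝ f' g / r ≤ 2 * √x := by
    rw [div_le_iff₀ hr]
    linarith
  rw [inner_add_right, add_div]
  linarith

namespace LayeredCode

variable {n L : ℕ} {δ : ℝ} (K : LayeredCode n L δ)

/-- The decoding region with tolerance `t` in place of `log n`. -/
def decoderAt (t : ℝ) (m : K.Message) : Set (Fin n → Bool) :=
  {y | ∀ ℓ, ‖K.lineProj m.1 ℓ (vertex y) - K.point m.1 (ℓ.val + 1)‖ ≤ t}

theorem decoderAt_log : K.decoderAt (Real.log n) = K.decoder := by
  ext m y
  simp [decoderAt, decoder, layerDecoder]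

theorem point_succ (s : (ℓ : Fin L) → Fin (K.num ℓ)) (ℓ : Fin L) :
    K.point s (ℓ.val + 1) = K.point s ℓ.val + K.dir s ℓ := by
  have : (Finset.univ.filter fun i : Fin L => i.val < ℓ.val + 1) =
      insert ℓ (Finset.univ.filter fun i : Fin L => i.val < ℓ.val) := by
    ext i
    simp only [Finset.mem_filter_univ, Finset.mem_insert, Fin.ext_iff]
    omega
  rw [point, point, this, Finset.sum_insert (by simp)]
  abel

theorem point_length_sub (s : (ℓ : Fin L) → Fin (K.num ℓ)) (ℓ : Fin L) :
    K.point s L - K.point s ℓ.val = K.dir s ℓ + ∑ i with ℓ < i, K.dir s i := by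
  have h1 : (Finset.univ.filter fun i : Fin L => i.val < L) =
      (Finset.univ.filter fun i : Fin L => i.val < ℓ.val) ∪
        insert ℓ (Finset.univ.filter fun i : Fin L => ℓ < i) := by
    ext i
    simp only [Finset.mem_filter_univ, Finset.mem_union, Finset.mem_insert, Fin.ext_iff,
      Fin.lt_def]
    omega
  have h2 : Disjoint (Finset.univ.filter fun i : Fin L => i.val < ℓ.val)
      (insert ℓ (Finset.univ.filter fun i : Fin L => ℓ < i)) := by
    rw [Finset.disjoint_left]
    intro i
    simp only [Finset.mem_filter_univ, Finset.mem_insert, Fin.ext_iff, Fin.lt_def]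
    omega
  rw [point, point, h1, Finset.sum_union h2, Finset.sum_insert (by simp)]
  abel

theorem inner_dir_vertex_sub (s : (ℓ : Fin L) → Fin (K.num ℓ)) (ℓ : Fin L) (m : K.Message)
    (y : Fin n → Bool) :
    inner ℝ (K.dir s ℓ) (vertex y - K.point m.1 L) =
      ∑ j, K.dir s ℓ j * ((if y j then 1 else 0) - (K.word m j : ℝ)) := by
  rw [PiLp.inner_apply]
  refine Finset.sum_congr rfl fun j _ => ?_
  simp [vertex, word, mul_comm]

/-- Splits the statistic of the tested string `s`, when `m` was sent, into centred noise and a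
deterministic offset. The offset vanishes if `s` is the string of `m`, and is large at the first
layer where they differ. -/
theorem norm_lineProj_sub (hn : 0 < n) (s : (ℓ : Fin L) → Fin (K.num ℓ)) (ℓ : Fin L)
    (m : K.Message) (y : Fin n → Bool) :
    ‖K.lineProj s ℓ (vertex y) - K.point s (ℓ.val + 1)‖ =
      |∑ j, K.dir s ℓ j / ‖K.dir s ℓ‖ * ((if y j then 1 else 0) - (K.word m j : ℝ)) -
        (‖K.dir s ℓ‖ - inner ℝ (K.dir s ℓ) (K.point m.1 L - K.point s ℓ.val) / ‖K.dir s ℓ‖)| := by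
  have hpos : 0 < ‖K.dir s ℓ‖ := by
    rw [norm_dir]
    positivity
  have h0 : K.dir s ℓ ≠ 0 := norm_pos_iff.1 hpos
  have h1 : K.lineProj s ℓ (vertex y) - K.point s (ℓ.val + 1) =
      (Submodule.span ℝ {K.dir s ℓ}).starProjection (vertex y - K.point s ℓ.val) - K.dir s ℓ := by
    rw [lineProj, point_succ]
    abel
  have h2 : vertex y - K.point s ℓ.val =
      (vertex y - K.point m.1 L) + (K.point m.1 L - K.point s ℓ.val) := by abel
  have h3 : ∑ j, K.dir s ℓ j / ‖K.dir s ℓ‖ * ((if y j then 1 else 0) - (K.word m j : ℝ)) =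
      inner ℝ (K.dir s ℓ) (vertex y - K.point m.1 L) / ‖K.dir s ℓ‖ := by
    rw [inner_dir_vertex_sub, Finset.sum_div]
    exact Finset.sum_congr rfl fun j _ => by ring
  rw [h1, norm_starProjection_span_singleton_sub h0, h3, h2, inner_add_right, add_div]
  congr 1
  ring

theorem sum_dir_div_norm_sq (hn : 0 < n) (s : (ℓ : Fin L) → Fin (K.num ℓ)) (ℓ : Fin L) :
    ∑ j, (K.dir s ℓ j / ‖K.dir s ℓ‖) ^ 2 = 1 := by
  have hpos : 0 < ‖K.dir s ℓ‖ := by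
    rw [norm_dir]
    positivity
  simp_rw [div_pow]
  rw [← Finset.sum_div, ← EuclideanSpace.real_norm_sq_eq, div_self (by positivity)]

theorem sub_le_real_decoderAt (hn : 0 < n) {t : ℝ} (ht : 0 ≤ t) (m : K.Message) :
    1 - L * (2 * Real.exp (-2 * t ^ 2)) ≤
      (blockOutput bernoulliChannel (K.word m)).real (K.decoderAt t m) := by
  set μ := blockOutput bernoulliChannel (K.word m)
  have hcompl : μ.real (K.decoderAt t m)ᶜ ≤ L * (2 * Real.exp (-2 * t ^ 2)) := by
    have hsub : (K.decoderAt t m)ᶜ ⊆ ⋃ ℓ : Fin L, {y | t ≤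
        |∑ j, K.dir m.1 ℓ j / ‖K.dir m.1 ℓ‖ * ((if y j then 1 else 0) - (K.word m j : ℝ))|} := by
      intro y hy
      simp only [decoderAt, Set.mem_compl_iff, Set.mem_ofPred_eq, not_forall, not_le] at hy
      obtain ⟨ℓ, hℓ⟩ := hy
      refine Set.mem_iUnion.2 ⟨ℓ, ?_⟩
      have hinner : inner ℝ (K.dir m.1 ℓ) (K.point m.1 L - K.point m.1 ℓ.val) =
          ‖K.dir m.1 ℓ‖ * ‖K.dir m.1 ℓ‖ := by
        rw [point_length_sub, inner_add_right, real_inner_self_eq_norm_mul_norm, inner_sum,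
          Finset.sum_eq_zero, add_zero]
        intro i hi
        rw [inner_dir, K.vec_orthogonal _ _ _ (Finset.mem_filter_univ _ |>.1 hi).ne]
      have hpos : 0 < ‖K.dir m.1 ℓ‖ := by
        rw [norm_dir]
        positivity
      rw [K.norm_lineProj_sub hn m.1 ℓ m, hinner, mul_div_cancel_right₀ _ hpos.ne', sub_self,
        sub_zero] at hℓ
      exact hℓ.le
    refine (measureReal_mono hsub).trans ((measureReal_iUnion_fintype_le _).trans ?_)
    calc _ ≤ ∑ _ℓ : Fin L, 2 * Real.exp (-2 * t ^ 2) := by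
          refine Finset.sum_le_sum fun ℓ _ => ?_
          have := blockOutput_real_le_abs_sum_le_exp (K.word m)
            (fun j => K.dir m.1 ℓ j / ‖K.dir m.1 ℓ‖) one_pos
            (K.sum_dir_div_norm_sq hn m.1 ℓ).le ht
          rwa [div_one] at this
      _ = _ := by simp
  have := probReal_compl_eq_one_sub (μ := μ) (Set.toFinite (K.decoderAt t m)).measurableSet
  linarith

theorem real_decoderAt_le (hlog : 22 ≤ Real.log n)
    (hsum : ∀ ℓ : Fin L, ∑ i : Fin L with ℓ < i, ((n : ℝ) ^ ((1 - δ) / 2 ^ (i.val + 1))) ^ 2 ≤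
      2 * (n : ℝ) ^ ((1 - δ) / 2 ^ (ℓ.val + 1)))
    {t : ℝ} (ht : t ≤ Real.log n + 1) {m m' : K.Message} (hm : m ≠ m') :
    (blockOutput bernoulliChannel (K.word m)).real (K.decoderAt t m') ≤
      Real.exp (-2 * Real.log n ^ 2) := by
  have hn : 0 < n := by
    rcases Nat.eq_zero_or_pos n with rfl | h
    · norm_num at hlog
    · exact h
  have hne : m.1 ≠ m'.1 := fun h => hm (Subtype.ext h)
  -- At the first differing layer both strings still start from the same point, so angle-density
  -- applies to their vectors there.
  obtain ⟨ℓ, hℓ, hmin⟩ := wellFounded_lt.has_min {ℓ : Fin L | m.1 ℓ ≠ m'.1 ℓ}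
    (Function.ne_iff.1 hne)
  have heq : ∀ i < ℓ, m.1 i = m'.1 i := fun i hi => by
    by_contra h
    exact hmin i h hi
  set r := (n : ℝ) ^ ((1 - δ) / 2 ^ (ℓ.val + 1)) with hr
  have hr0 : 0 < r := by positivity
  have hpoint : K.point m'.1 ℓ.val = K.point m.1 ℓ.val := by
    rw [point, point]
    congr 1
    refine Finset.sum_congr rfl fun i hi => ?_
    have hi' : i < ℓ := by simpa using hi
    rw [dir, dir, K.vec_congr m'.1 m.1 i fun j hj => (heq j (hj.trans_lt hi')).symm]
  have hangle : 3 * Real.log n ≤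
      ‖(Submodule.span ℝ {K.dir m'.1 ℓ}).starProjection (K.dir m.1 ℓ) - K.dir m'.1 ℓ‖ := by
    have hpos : ∀ s : (ℓ : Fin L) → Fin (K.num ℓ), K.vec s ℓ ≠ 0 ∧ K.dir s ℓ ≠ 0 := fun s => by
      rw [← norm_pos_iff, ← norm_pos_iff, norm_vec, norm_dir]
      exact ⟨hr0, hr0⟩
    have h := (K.vec_angleDense m.1 ℓ).2 (m.1 ℓ) (m'.1 ℓ) hℓ
    have hvec : K.vec (Function.update m.1 ℓ (m'.1 ℓ)) ℓ = K.vec m'.1 ℓ :=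
      K.vec_congr _ _ ℓ fun i hi => by
        rcases hi.eq_or_lt with rfl | hi
        · simp
        · rw [Function.update_of_ne hi.ne, heq i hi]
    simp only [Function.update_eq_self] at h
    rw [norm_starProjection_span_singleton_sub (hpos _).1, norm_vec, hvec] at h
    rwa [norm_starProjection_span_singleton_sub (hpos _).2, norm_dir, inner_dir]
  have hmargin : 2 * Real.log n + 1 ≤
      r - inner ℝ (K.dir m'.1 ℓ) (K.point m.1 L - K.point m'.1 ℓ.val) / r := by
    rw [hpoint, point_length_sub]
    refine add_one_le_sub_inner_div hr0 hlog (K.norm_dir _ _) (K.norm_dir _ _) hangle ?_ ?_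
    · rw [inner_sum, Finset.sum_eq_zero]
      intro i hi
      rw [inner_dir, K.vec_orthogonal _ _ _ (Finset.mem_filter_univ _ |>.1 hi).ne]
    · rw [norm_sum_dir_sq]
      exact hsum ℓ
  -- The offset is at least `2 log n + 1` and the tolerance at most `log n + 1`, so acceptance needs
  -- noise of at least `log n`, in one direction only.
  have hsub : K.decoderAt t m' ⊆ {y | Real.log n ≤
      ∑ j, K.dir m'.1 ℓ j / ‖K.dir m'.1 ℓ‖ * ((if y j then 1 else 0) - (K.word m j : ℝ))} := by
    intro y hy
    have h := hy ℓ
    rw [K.norm_lineProj_sub hn m'.1 ℓ m] at h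
    have h1 := (abs_le.1 h).1
    have h2 := K.norm_dir m'.1 ℓ
    rw [← hr] at h2
    rw [Set.mem_ofPred_eq]
    rw [h2] at h1 ⊢
    linarith
  refine (measureReal_mono hsub).trans ?_
  have := blockOutput_real_le_sum_le_exp (K.word m)
    (fun j => K.dir m'.1 ℓ j / ‖K.dir m'.1 ℓ‖) one_pos
    (K.sum_dir_div_norm_sq hn m'.1 ℓ).le (by linarith : 0 ≤ Real.log n)
  rwa [div_one] at this

theorem isDICode_decoderAt (hL : 1 ≤ L) (hlog : 22 ≤ Real.log n)
    (hsum : ∀ ℓ : Fin L, ∑ i : Fin L with ℓ < i, ((n : ℝ) ^ ((1 - δ) / 2 ^ (i.val + 1))) ^ 2 ≤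
      2 * (n : ℝ) ^ ((1 - δ) / 2 ^ (ℓ.val + 1)))
    {t : ℝ} (ht0 : 0 ≤ t) (ht : t ≤ Real.log n + 1) :
    IsDICode bernoulliChannel K.word (K.decoderAt t) (L * (2 * Real.exp (-2 * t ^ 2))) (lam n) where
  pos₁ := by positivity
  pos₂ := by
    unfold lam
    positivity
  measurableSet _ := (Set.toFinite _).measurableSet
  missed m := by
    refine K.sub_le_real_decoderAt ?_ ht0 m
    rcases Nat.eq_zero_or_pos n with rfl | h
    · norm_num at hlog
    · exact h
  falseId m m' hm := by
    refine (K.real_decoderAt_le hlog hsum ht hm).trans ?_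
    unfold lam
    linarith [Real.exp_pos (-2 * Real.log n ^ 2)]

end LayeredCode

/-! ### Size of the layered codes -/

theorem sum_Ico_add_le {a : ℕ → ℝ} {L : ℕ} (h : ∀ i < L, 2 * a (i + 1) ≤ a i) {k m : ℕ}
    (hkm : k ≤ m) (hm : m ≤ L) : ∑ i ∈ Finset.Ico k m, a i + 2 * a m ≤ 2 * a k := by
  induction m, hkm using Nat.le_induction with
  | base => simp
  | succ m hkm ih =>
    rw [Finset.sum_Ico_succ_top hkm]
    linarith [ih (by omega), h m (by omega)]

theorem radius_sq {x : ℝ} (hx : 0 ≤ x) (β : ℝ) (i : ℕ) :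
    (x ^ (β / 2 ^ (i + 1))) ^ 2 = x ^ (β / 2 ^ i) := by
  rw [← Real.rpow_natCast, ← Real.rpow_mul hx]
  congr 1
  push_cast
  field_simp
  ring

/-- The squared radii of the layers `k, k + 1, …` add up to at most twice the first of them. -/
theorem sum_Ico_radius_le {x β : ℝ} {L : ℕ} (hx : 1 ≤ x) (hβ : 0 ≤ β)
    (h4 : 4 ≤ x ^ (β / 2 ^ L)) {k : ℕ} (hk : k ≤ L) :
    ∑ i ∈ Finset.Ico k L, x ^ (β / 2 ^ i) ≤ 2 * x ^ (β / 2 ^ k) := by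
  have hx0 : 0 ≤ x := by linarith
  have hstep : ∀ i < L, 2 * x ^ (β / 2 ^ (i + 1)) ≤ x ^ (β / 2 ^ i) := by
    intro i hi
    have h1 : 4 ≤ x ^ (β / 2 ^ (i + 1)) := by
      refine h4.trans (Real.rpow_le_rpow_of_exponent_le hx ?_)
      gcongr
      · norm_num
      · omega
    -- The square of a radius that is at least `4` exceeds twice that radius.
    rw [← radius_sq hx0 β i]
    nlinarith
  have := sum_Ico_add_le (a := fun i => x ^ (β / 2 ^ i)) hstep hk le_rfl
  linarith

theorem sum_Fin_filter_lt {L : ℕ} (f : ℕ → ℝ) (k : ℕ) :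
    ∑ i : Fin L with k ≤ i.val, f i = ∑ i ∈ Finset.Ico k L, f i := by
  refine Finset.sum_bij (fun i _ => i.val) ?_ ?_ ?_ ?_
  · intro i hi
    have := (Finset.mem_filter_univ _).1 hi
    exact Finset.mem_Ico.2 ⟨this, i.2⟩
  · intro i _ j _ h
    exact Fin.ext h
  · intro i hi
    have := Finset.mem_Ico.1 hi
    exact ⟨⟨i, this.2⟩, (Finset.mem_filter_univ _).2 this.1, rfl⟩
  · intro i _
    rfl

theorem log_natCast_mono {a b : ℕ} (h : a ≤ b) : Real.log a ≤ Real.log b := by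
  rcases Nat.eq_zero_or_pos a with rfl | ha
  · simpa using Real.log_natCast_nonneg b
  · exact Real.log_le_log (by exact_mod_cast ha) (by exact_mod_cast h)

theorem sum_Icc_exponent (L : ℕ) (δ : ℝ) :
    ∑ ℓ : Fin L, (1 - δ) / 2 ^ (ℓ.val + 1) = ∑ ℓ ∈ Finset.Icc 1 L, (1 - δ) / 2 ^ ℓ := by
  rw [Fin.sum_univ_eq_sum_range (fun i => (1 - δ) / 2 ^ (i + 1)), Finset.range_eq_Ico,
    Finset.sum_Ico_add' (fun i => (1 - δ) / 2 ^ i)]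
  rfl

theorem sum_Icc_exponent_eq (L : ℕ) (δ : ℝ) :
    ∑ ℓ ∈ Finset.Icc 1 L, (1 - δ) / 2 ^ ℓ = (1 - δ) * (1 - 1 / 2 ^ L) := by
  induction L with
  | zero => simp
  | succ L ih =>
    rw [Finset.sum_Icc_succ_top (by omega), ih]
    field_simp
    ring

namespace LayeredCode

theorem le_log_primitiveSize {n L : ℕ} {δ : ℝ} (K : LayeredCode n L δ) (hδ0 : 0 ≤ δ) (hδ : δ < 1)
    (hlog : 22 ≤ Real.log n) (hn : L + 1 ≤ n)
    (hr : ∀ ℓ < L, 24 * Real.log n ≤ (n : ℝ) ^ ((1 - δ) / 2 ^ (ℓ + 1)))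
    (hnum : ∀ ℓ : Fin L, K.num ℓ = ⌈((n : ℝ) ^ ((1 - δ) / 2 ^ (ℓ.val + 1)) /
      (24 * Real.log n)) ^ (((n - (L + 1) : ℕ) : ℝ) / 2)⌉₊) :
    0 < K.primitiveSize ∧
    n * Real.log n * (1 / 2 * ∑ ℓ ∈ Finset.Icc 1 L, (1 - δ) / 2 ^ ℓ) -
      (L * (L + 4) / 2) * (n * Real.log (Real.log n)) ≤ Real.log K.primitiveSize := by
  have hn0 : (0 : ℝ) < n := by
    have : 0 < n := by omega
    exact_mod_cast this
  have hlog0 : 0 < Real.log n := by linarith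
  have hll : 1 ≤ Real.log (Real.log n) := by
    rw [Real.le_log_iff_exp_le hlog0]
    linarith [Real.exp_one_lt_d9]
  have h24 : Real.log (24 * Real.log n) ≤ 3 * Real.log (Real.log n) := by
    have : 3 * Real.log (Real.log n) = Real.log (Real.log n ^ 3) := by
      rw [Real.log_pow]
      norm_num
    rw [this]
    refine Real.log_le_log (by positivity) ?_
    nlinarith [mul_self_nonneg (Real.log n)]
  have hx : ∀ ℓ : Fin L, 1 ≤ (n : ℝ) ^ ((1 - δ) / 2 ^ (ℓ.val + 1)) / (24 * Real.log n) := fun ℓ => by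
    rw [le_div_iff₀ (by positivity), one_mul]
    exact hr ℓ ℓ.2
  have hpos : ∀ ℓ : Fin L, 0 < K.num ℓ := fun ℓ => by
    rw [hnum, Nat.ceil_pos]
    have := hx ℓ
    positivity
  have hlayer : ∀ ℓ : Fin L, n * Real.log n * (1 / 2 * ((1 - δ) / 2 ^ (ℓ.val + 1))) -
      ((L + 4 : ℝ) / 2) * (n * Real.log (Real.log n)) ≤ Real.log (K.num ℓ) := by
    intro ℓ
    have h1 : Real.log ((n : ℝ) ^ ((1 - δ) / 2 ^ (ℓ.val + 1)) / (24 * Real.log n)) =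
        (1 - δ) / 2 ^ (ℓ.val + 1) * Real.log n - Real.log (24 * Real.log n) := by
      rw [Real.log_div (by positivity) (by positivity), Real.log_rpow hn0]
    have h2 : ((n - (L + 1) : ℕ) : ℝ) / 2 * ((1 - δ) / 2 ^ (ℓ.val + 1) * Real.log n -
        Real.log (24 * Real.log n)) ≤ Real.log (K.num ℓ) := by
      have h0 := hx ℓ
      rw [← h1, ← Real.log_rpow (by positivity), hnum]
      exact Real.log_le_log (by positivity) (Nat.le_ceil _)
    refine le_trans ?_ h2
    rw [Nat.cast_sub hn]
    push_cast
    set α := (1 - δ) / 2 ^ (ℓ.val + 1)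
    have hα0 : 0 ≤ α := div_nonneg (by linarith) (by positivity)
    have hα1 : α ≤ 1 := by
      refine div_le_one_of_le₀ ?_ (by positivity)
      linarith [one_le_pow₀ (one_le_two : (1 : ℝ) ≤ 2) (n := ℓ.val + 1)]
    -- Pays for the `L + 1` missing dimensions; with `log (24 log n) ≤ 3 log log n` the loss per
    -- layer is `(L + 1 + 3) / 2` times `n log log n`.
    have h3 : α * Real.log n ≤ n * Real.log (Real.log n) :=
      calc α * Real.log n ≤ 1 * Real.log n := by gcongr
        _ ≤ n * 1 := by linarith [Real.log_le_self hn0.le]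
        _ ≤ _ := by gcongr
    have h4 : 0 ≤ Real.log (24 * Real.log n) := Real.log_nonneg (by linarith)
    have h5 : n * Real.log (24 * Real.log n) ≤ n * (3 * Real.log (Real.log n)) := by gcongr
    have h6 : (L + 1 : ℝ) * (α * Real.log n) ≤ (L + 1) * (n * Real.log (Real.log n)) := by gcongr
    have h7 : 0 ≤ (L + 1 : ℝ) * Real.log (24 * Real.log n) := by positivity
    linarith
  refine ⟨Finset.prod_pos fun ℓ _ => hpos ℓ, ?_⟩
  rw [primitiveSize, Nat.cast_prod, Real.log_prod fun ℓ _ => by exact_mod_cast (hpos ℓ).ne',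
    ← sum_Icc_exponent]
  refine le_trans (le_of_eq ?_) (Finset.sum_le_sum fun ℓ _ => hlayer ℓ)
  rw [Finset.sum_sub_distrib, ← Finset.mul_sum, ← Finset.mul_sum]
  simp only [Finset.sum_const, Finset.card_univ, Fintype.card_fin, nsmul_eq_mul]
  ring

end LayeredCode

/-- Good layered codes, decoded with any tolerance between `0` and `log n + 1`. -/
theorem exists_layeredCode {n L : ℕ} {δ : ℝ} (hL : 1 ≤ L) (hδ0 : 0 < δ) (hδ : δ < 1)
    (hlog : 22 ≤ Real.log n) (hn : L + 1 ≤ n)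
    (hr : 24 * Real.log n ≤ (n : ℝ) ^ ((1 - δ) / 2 ^ L))
    (hexp : 2 * n * Real.exp (-(1 / 4 * (n : ℝ) ^ δ / 8)) ≤ 1 / 2) :
    ∃ K : LayeredCode n L δ,
      (∀ t, 0 ≤ t → t ≤ Real.log n + 1 → IsDICode bernoulliChannel K.word (K.decoderAt t)
        (L * (2 * Real.exp (-2 * t ^ 2))) (lam n)) ∧
      K.primitiveSize * (1 - 2 * n * Real.exp (-(1 / 4 * (n : ℝ) ^ δ / 8))) ≤ K.size ∧
      1 / 2 * ∑ ℓ ∈ Finset.Icc 1 L, (1 - δ) / 2 ^ ℓ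
          - (L * (L + 4) / 2 + 1) * (Real.log (Real.log n) / Real.log n) ≤ linRate n K.size := by
  have hn1 : (1 : ℝ) ≤ n := by
    have : 1 ≤ n := by omega
    exact_mod_cast this
  have hn0 : (0 : ℝ) < n := by linarith
  have hlog0 : 0 < Real.log n := by linarith
  have hr' : ∀ ℓ < L, 24 * Real.log n ≤ (n : ℝ) ^ ((1 - δ) / 2 ^ (ℓ + 1)) := fun ℓ hℓ => by
    refine hr.trans (Real.rpow_le_rpow_of_exponent_le hn1 ?_)
    gcongr
    · linarith
    · exact hℓ
  have h4 : 4 ≤ (n : ℝ) ^ ((1 - δ) / 2 ^ L) := by linarith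
  have hsum : ∀ k ≤ L, ∑ i : Fin L with k ≤ i.val, ((n : ℝ) ^ ((1 - δ) / 2 ^ (i.val + 1))) ^ 2 ≤
      2 * (n : ℝ) ^ ((1 - δ) / 2 ^ k) := fun k hk => by
    simp_rw [radius_sq hn0.le]
    rw [sum_Fin_filter_lt (fun i => (n : ℝ) ^ ((1 - δ) / 2 ^ i))]
    exact sum_Ico_radius_le hn1 (by linarith) h4 hk
  obtain ⟨K₀, hK₀⟩ := LayeredCode.exists_num_eq (k := n - (L + 1)) (by omega) hlog0 hr'
  obtain ⟨K, hnum, hsize⟩ := K₀.exists_num_eq_primitiveSize_le_size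
    (S := 2 * (n : ℝ) ^ (1 - δ)) (by positivity) (by simpa using hsum 0 (Nat.zero_le _))
  -- The origin of `c = 1/4`.
  have hexponent : (n : ℝ) / (16 * (2 * (n : ℝ) ^ (1 - δ))) = 1 / 4 * (n : ℝ) ^ δ / 8 := by
    rw [Real.rpow_sub hn0, Real.rpow_one]
    field_simp
    norm_num
  rw [hexponent] at hsize
  refine ⟨K, fun t ht0 ht => K.isDICode_decoderAt hL hlog (fun ℓ => hsum (ℓ + 1) ℓ.2) ht0 ht,
    hsize, ?_⟩
  obtain ⟨hpos, hprim⟩ := K.le_log_primitiveSize hδ0.le hδ hlog hn hr' fun ℓ => by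
    rw [hnum]
    exact hK₀ ℓ
  have hpos' : (0 : ℝ) < K.primitiveSize := by exact_mod_cast hpos
  have hhalf : (K.primitiveSize : ℝ) / 2 ≤ K.size := by
    refine le_trans ?_ hsize
    rw [div_eq_mul_one_div]
    gcongr
    linarith
  -- Expurgation loses at most half of the words; this is the `+ 1` in the constant.
  have hlogsize : Real.log K.primitiveSize - Real.log 2 ≤ Real.log K.size := by
    rw [← Real.log_div hpos'.ne' two_ne_zero]
    exact Real.log_le_log (by positivity) hhalf
  have hll : 1 ≤ Real.log (Real.log n) := by
    rw [Real.le_log_iff_exp_le hlog0]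
    linarith [Real.exp_one_lt_d9]
  have hlog2 : Real.log 2 ≤ n * Real.log (Real.log n) := by
    have : (1 : ℝ) ≤ n * Real.log (Real.log n) := one_le_mul_of_one_le_of_one_le hn1 hll
    linarith [Real.log_two_lt_d9]
  rw [linRate, le_div_iff₀ (by positivity)]
  have hmul : (1 / 2 * ∑ ℓ ∈ Finset.Icc 1 L, (1 - δ) / 2 ^ ℓ
      - (L * (L + 4) / 2 + 1) * (Real.log (Real.log n) / Real.log n)) * (n * Real.log n) =
      n * Real.log n * (1 / 2 * ∑ ℓ ∈ Finset.Icc 1 L, (1 - δ) / 2 ^ ℓ) -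
      (L * (L + 4) / 2 + 1) * (n * Real.log (Real.log n)) := by
    field_simp
  rw [hmul]
  linarith

/-! ### Asymptotics in the block length -/

theorem tendsto_log_natCast : Tendsto (fun n : ℕ => Real.log n) atTop atTop :=
  Real.tendsto_log_atTop.comp tendsto_natCast_atTop_atTop

theorem eventually_mul_log_le_rpow (c : ℝ) {β : ℝ} (hβ : 0 < β) :
    ∀ᶠ n : ℕ in atTop, c * Real.log n ≤ (n : ℝ) ^ β := by
  have h := ((isLittleO_log_rpow_atTop hβ).const_mul_left c).comp_tendsto
    (tendsto_natCast_atTop_atTop (R := ℝ))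
  filter_upwards [h.bound one_pos] with n hn
  simp only [Function.comp, one_mul] at hn
  rw [Real.norm_of_nonneg (by positivity : (0 : ℝ) ≤ (n : ℝ) ^ β)] at hn
  exact (le_abs_self _).trans hn

theorem eventually_mul_exp_neg_rpow_le {δ : ℝ} (hδ : 0 < δ) :
    ∀ᶠ n : ℕ in atTop, 2 * n * Real.exp (-(1 / 4 * (n : ℝ) ^ δ / 8)) ≤ 1 / 2 := by
  have h := (tendsto_rpow_mul_exp_neg_mul_atTop_nhds_zero (1 / δ) (1 / 32) (by norm_num)).comp
    ((tendsto_rpow_atTop hδ).comp (tendsto_natCast_atTop_atTop (R := ℝ)))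
  filter_upwards [h.eventually_le_const (show (0 : ℝ) < 1 / 4 by norm_num)] with n hn
  simp only [Function.comp] at hn
  rw [← Real.rpow_mul (by positivity), mul_one_div_cancel hδ.ne', Real.rpow_one] at hn
  have : -(1 / 4 * (n : ℝ) ^ δ / 8) = -(1 / 32) * (n : ℝ) ^ δ := by ring
  rw [this]
  linarith

theorem eventually_exists_layeredCode {L : ℕ} {δ : ℝ} (hL : 1 ≤ L) (hδ0 : 0 < δ) (hδ : δ < 1) :
    ∀ᶠ n : ℕ in atTop, ∃ K : LayeredCode n L δ,
      (∀ t, 0 ≤ t → t ≤ Real.log n + 1 → IsDICode bernoulliChannel K.word (K.decoderAt t)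
        (L * (2 * Real.exp (-2 * t ^ 2))) (lam n)) ∧
      K.primitiveSize * (1 - 2 * n * Real.exp (-(1 / 4 * (n : ℝ) ^ δ / 8))) ≤ K.size ∧
      1 / 2 * ∑ ℓ ∈ Finset.Icc 1 L, (1 - δ) / 2 ^ ℓ
          - (L * (L + 4) / 2 + 1) * (Real.log (Real.log n) / Real.log n) ≤ linRate n K.size := by
  filter_upwards [tendsto_log_natCast.eventually_ge_atTop 22, eventually_ge_atTop (L + 1),
    eventually_mul_log_le_rpow 24 (β := (1 - δ) / 2 ^ L) (div_pos (by linarith) (by positivity)),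
    eventually_mul_exp_neg_rpow_le hδ0] with n h1 h2 h3 h4
  exact exists_layeredCode hL hδ0 hδ h1 h2 h3 h4

theorem exists_forall_eventually_half_sub_le {ε : ℝ} (hε : 0 < ε) :
    ∃ (L₀ : ℕ) (δ₀ : ℝ), 1 ≤ L₀ ∧ 0 < δ₀ ∧
      ∀ L : ℕ, L₀ ≤ L → ∀ δ : ℝ, 0 < δ → δ < δ₀ → ∀ᶠ n : ℕ in atTop, ∃ K : LayeredCode n L δ,
        (∀ t, 0 ≤ t → t ≤ Real.log n + 1 → IsDICode bernoulliChannel K.word (K.decoderAt t)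
          (L * (2 * Real.exp (-2 * t ^ 2))) (lam n)) ∧
        1 / 2 - ε ≤ linRate n K.size := by
  obtain ⟨L₀, hL₀⟩ := exists_pow_lt_of_lt_one (show (0 : ℝ) < ε / 2 by positivity)
    (show (1 / 2 : ℝ) < 1 by norm_num)
  refine ⟨max L₀ 1, min (ε / 2) 1, le_max_right _ _, by positivity, ?_⟩
  intro L hL δ hδ0 hδ
  have hδ1 : δ < 1 := hδ.trans_le (min_le_right _ _)
  have hδε : δ < ε / 2 := hδ.trans_le (min_le_left _ _)
  have hLL : 1 ≤ L := (le_max_right _ _).trans hL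
  have hpow : (1 : ℝ) / 2 ^ L < ε / 2 := by
    rw [← one_div_pow]
    exact (pow_le_pow_of_le_one (by norm_num) (by norm_num) ((le_max_left _ _).trans hL)).trans_lt
      hL₀
  have hzero : Tendsto (fun n : ℕ => (L * (L + 4) / 2 + 1 : ℝ) *
      (Real.log (Real.log n) / Real.log n)) atTop (𝓝 0) := by
    have h := (Real.isLittleO_log_id_atTop.tendsto_div_nhds_zero.comp
      tendsto_log_natCast).const_mul (L * (L + 4) / 2 + 1 : ℝ)
    rw [mul_zero] at h
    exact h
  filter_upwards [eventually_exists_layeredCode hLL hδ0 hδ1,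
    hzero.eventually_le_const (show (0 : ℝ) < ε / 2 by positivity)] with n ⟨K, hK, _, hrate⟩ hn
  refine ⟨K, hK, le_trans ?_ hrate⟩
  rw [sum_Icc_exponent_eq]
  have : 0 < (1 : ℝ) / 2 ^ L := by positivity
  nlinarith

/-! ### Codes of every block length -/

theorem HasDICode.mono {X Y : Type*} [MeasurableSpace X] [MeasurableSpace Y] {W : Kernel X Y}
    {n N N' : ℕ} {ε₁ ε₂ ε₁' : ℝ} (h : HasDICode W n N ε₁ ε₂) (hN : N' ≤ N)
    (h₁ : ε₁ ≤ ε₁') : HasDICode W n N' ε₁' ε₂ := by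
  obtain ⟨u, D, h⟩ := h
  exact ⟨fun i => u (Fin.castLE hN i), fun i => D (Fin.castLE hN i),
    { pos₁ := h.pos₁.trans_le h₁
      pos₂ := h.pos₂
      measurableSet := fun _ => h.measurableSet _
      missed := fun _ => le_trans (by linarith) (h.missed _)
      falseId := fun _ _ hij => h.falseId _ _ fun h' => hij (Fin.castLE_injective hN h') }⟩

theorem IsDICode.hasDICode {X Y : Type*} [MeasurableSpace X] [MeasurableSpace Y] {W : Kernel X Y}
    {n : ℕ} {M : Type*} [Finite M] {u : M → Fin n → X} {D : M → Set (Fin n → Y)} {ε₁ ε₂ : ℝ}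
    (h : IsDICode W u D ε₁ ε₂) : HasDICode W n (Nat.card M) ε₁ ε₂ :=
  ⟨fun i => u ((Finite.equivFin M).symm i), fun i => D ((Finite.equivFin M).symm i),
    { pos₁ := h.pos₁
      pos₂ := h.pos₂
      measurableSet := fun _ => h.measurableSet _
      missed := fun _ => h.missed _
      falseId := fun _ _ hij => h.falseId _ _ fun h' => hij ((Finite.equivFin M).symm.injective h') }⟩

theorem hasDICode_zero {X Y : Type*} [MeasurableSpace X] [MeasurableSpace Y] (W : Kernel X Y)
    (n : ℕ) {ε₁ ε₂ : ℝ} (h₁ : 0 < ε₁) (h₂ : 0 < ε₂) : HasDICode W n 0 ε₁ ε₂ :=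
  ⟨fun i => i.elim0, fun i => i.elim0, ⟨h₁, h₂, fun i => i.elim0, fun i => i.elim0,
    fun i => i.elim0⟩⟩

theorem lam_pos (n : ℕ) : 0 < lam n := by
  unfold lam
  positivity

theorem tendsto_lam : Tendsto lam atTop (𝓝 0) := by
  have h : Tendsto (fun n : ℕ => 2 * Real.log n ^ 2) atTop atTop :=
    ((tendsto_pow_atTop two_ne_zero).comp tendsto_log_natCast).const_mul_atTop two_pos
  have := ((Real.tendsto_exp_neg_atTop_nhds_zero.comp h).const_mul 2)
  rw [mul_zero] at this
  refine this.congr fun n => ?_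
  simp only [lam, Function.comp]
  rw [neg_mul]

instance {n L : ℕ} {δ : ℝ} (K : LayeredCode n L δ) : Finite K.Message :=
  inferInstanceAs (Finite {s : (ℓ : Fin L) → Fin (K.num ℓ) //
    ∀ t, K.point s L t ∈ Set.Icc (0 : ℝ) 1})

/-- A slightly larger tolerance absorbs the union bound over the layers. -/
theorem eventually_exists_hasDICode_lam {ε : ℝ} (hε : 0 < ε) :
    ∀ᶠ n : ℕ in atTop, ∃ N, HasDICode bernoulliChannel n N (lam n) (lam n) ∧
      1 / 2 - ε ≤ linRate n N := by
  obtain ⟨L, δ₀, hL, hδ₀, h⟩ := exists_forall_eventually_half_sub_le hε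
  filter_upwards [h L le_rfl (δ₀ / 2) (by positivity) (by linarith), eventually_ge_atTop L]
    with n ⟨K, hK, hrate⟩ hLn
  refine ⟨K.size, ?_, hrate⟩
  have hlog0 := Real.log_natCast_nonneg n
  refine (hK (Real.log n + 1) (by linarith) le_rfl).hasDICode.mono le_rfl ?_
  have hn0 : (0 : ℝ) < n := by
    have : 0 < n := by omega
    exact_mod_cast this
  -- Once `n ≥ L`, the factor `L` is at most `exp (log n)`, which the cross term `-4 log n` in the
  -- exponent outweighs.
  calc (L : ℝ) * (2 * Real.exp (-2 * (Real.log n + 1) ^ 2))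
      ≤ Real.exp (Real.log n) * (2 * Real.exp (-2 * (Real.log n + 1) ^ 2)) := by
        rw [Real.exp_log hn0]
        gcongr
    _ = 2 * Real.exp (Real.log n + -2 * (Real.log n + 1) ^ 2) := by
        rw [Real.exp_add]
        ring
    _ ≤ lam n := by
        unfold lam
        gcongr
        nlinarith

theorem tendsto_linRate_pow_half : Tendsto (fun n : ℕ => linRate n (n ^ (n / 2))) atTop (𝓝 (1 / 2)) := by
  have hlow : Tendsto (fun n : ℕ => (1 / 2 : ℝ) - 1 / 2 * (1 / (n : ℝ))) atTop (𝓝 (1 / 2)) := by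
    have := (tendsto_one_div_atTop_nhds_zero_nat (𝕜 := ℝ)).const_mul (1 / 2)
    simpa only [mul_zero, sub_zero] using this.const_sub (1 / 2)
  have hrate : ∀ᶠ n : ℕ in atTop, linRate n (n ^ (n / 2)) = ((n / 2 : ℕ) : ℝ) / n := by
    filter_upwards [tendsto_log_natCast.eventually_gt_atTop 0] with n hn
    rw [linRate, Nat.cast_pow, Real.log_pow, mul_div_mul_right _ _ hn.ne']
  refine tendsto_of_tendsto_of_tendsto_of_le_of_le' hlow tendsto_const_nhds ?_ ?_
  · filter_upwards [hrate, eventually_gt_atTop 0] with n hn hn0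
    have hn0' : (0 : ℝ) < n := by exact_mod_cast hn0
    rw [hn, le_div_iff₀ hn0']
    have h : (n : ℝ) ≤ 2 * ((n / 2 : ℕ) : ℝ) + 1 := by
      have : n ≤ 2 * (n / 2) + 1 := by omega
      exact_mod_cast this
    field_simp
    linarith
  · filter_upwards [hrate, eventually_gt_atTop 0] with n hn hn0
    have hn0' : (0 : ℝ) < n := by exact_mod_cast hn0
    rw [hn, div_le_iff₀ hn0']
    have h : 2 * ((n / 2 : ℕ) : ℝ) ≤ n := by
      have : 2 * (n / 2) ≤ n := by omega
      exact_mod_cast this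
    linarith

theorem linRate_mono (n : ℕ) {N N' : ℕ} (h : N ≤ N') : linRate n N ≤ linRate n N' := by
  have := Real.log_natCast_nonneg n
  unfold linRate
  exact div_le_div_of_nonneg_right (log_natCast_mono h) (mul_nonneg (Nat.cast_nonneg _) this)

open Classical in
-- The largest code size not exceeding `n ^ (n / 2)` is taken. The cap has rate tending to `1/2`,
-- which bounds the rate from above; from below, a good code is truncated to the cap if it is
-- larger. The empty code covers small `n`.
theorem achievesLinRate_half {L : ℕ} (hL : 1 ≤ L) :
    AchievesLinRate bernoulliChannel (fun n => L * lam n) lam (1 / 2) := by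
  have hlam : ∀ n, lam n ≤ L * lam n := fun n => by
    have : (1 : ℝ) ≤ L := by exact_mod_cast hL
    nlinarith [lam_pos n]
  refine ⟨by simpa using tendsto_lam.const_mul (L : ℝ), tendsto_lam,
    fun n => Nat.findGreatest (fun N => HasDICode bernoulliChannel n N (L * lam n) (lam n))
      (n ^ (n / 2)), fun n => ?_, ?_⟩
  · exact Nat.findGreatest_spec (P := fun N => HasDICode bernoulliChannel n N (L * lam n) (lam n))
      (Nat.zero_le _) (hasDICode_zero _ n ((lam_pos n).trans_le (hlam n)) (lam_pos n))
  · refine tendsto_order.2 ⟨fun a ha => ?_, fun a ha => ?_⟩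
    · filter_upwards [eventually_exists_hasDICode_lam (ε := (1 / 2 - a) / 2) (by linarith),
        tendsto_linRate_pow_half.eventually_const_lt ha] with n ⟨N, hN, hrate⟩ hn
      have hle := Nat.le_findGreatest
        (P := fun N => HasDICode bernoulliChannel n N (L * lam n) (lam n))
        (min_le_right N (n ^ (n / 2))) (hN.mono (min_le_left _ _) (hlam n))
      refine lt_of_lt_of_le ?_ (linRate_mono n hle)
      rcases min_choice N (n ^ (n / 2)) with h | h <;> rw [h]
      · linarith
      · exact hn
    · filter_upwards [tendsto_linRate_pow_half.eventually_lt_const ha] with n hn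
      exact (linRate_mono n (Nat.findGreatest_le _)).trans_lt hn

theorem LayeredCode.isDICode_decoder {n L : ℕ} {δ : ℝ} {K : LayeredCode n L δ}
    (hK : ∀ t, 0 ≤ t → t ≤ Real.log n + 1 → IsDICode bernoulliChannel K.word (K.decoderAt t)
      (L * (2 * Real.exp (-2 * t ^ 2))) (lam n)) :
    IsDICode bernoulliChannel K.word K.decoder (L * lam n) (lam n) := by
  rw [← K.decoderAt_log]
  exact hK _ (Real.log_natCast_nonneg n) (by linarith)

theorem mainTheorem3 :
    -- explicit rate and expurgation loss of the `L`-layer codes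
    (∃ c : ℝ, 0 < c ∧ ∀ L : ℕ, 1 ≤ L → ∀ δ : ℝ, 0 < δ → δ < 1 → ∃ C : ℝ, ∀ᶠ n : ℕ in atTop,
      ∃ K : LayeredCode n L δ,
        IsDICode bernoulliChannel K.word K.decoder (L * lam n) (lam n) ∧
        K.primitiveSize * (1 - 2 * n * Real.exp (-(c * (n : ℝ) ^ δ / 8))) ≤ K.size ∧
        1 / 2 * ∑ ℓ ∈ Finset.Icc 1 L, (1 - δ) / 2 ^ ℓ
          - C * (Real.log (Real.log n) / Real.log n) ≤ linRate n K.size) ∧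
    -- the rates of the `L`-layer codes come arbitrarily close to `1 / 2`
    (∀ ε : ℝ, 0 < ε → ∃ (L₀ : ℕ) (δ₀ : ℝ), 0 < δ₀ ∧
      ∀ L : ℕ, L₀ ≤ L → ∀ δ : ℝ, 0 < δ → δ < δ₀ → ∀ᶠ n : ℕ in atTop, ∃ K : LayeredCode n L δ,
        IsDICode bernoulliChannel K.word K.decoder (L * lam n) (lam n) ∧
        1 / 2 - ε ≤ linRate n K.size) ∧
    -- the rate `1 / 2` is achieved with these error bounds
    (∀ L : ℕ, 1 ≤ L → AchievesLinRate bernoulliChannel (fun n => L * lam n) lam (1 / 2)) := by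
  refine ⟨⟨1 / 4, by norm_num, fun L hL δ hδ0 hδ => ⟨L * (L + 4) / 2 + 1, ?_⟩⟩, fun ε hε => ?_,
    fun L hL => achievesLinRate_half hL⟩
  · filter_upwards [eventually_exists_layeredCode hL hδ0 hδ] with n ⟨K, hK, hsize, hrate⟩
    exact ⟨K, LayeredCode.isDICode_decoder hK, hsize, hrate⟩
  · obtain ⟨L₀, δ₀, _, hδ₀, h⟩ := exists_forall_eventually_half_sub_le hε
    refine ⟨L₀, δ₀, hδ₀, fun L hL δ hδ0 hδ => ?_⟩
    filter_upwards [h L hL δ hδ0 hδ] with n ⟨K, hK, hrate⟩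
    exact ⟨K, LayeredCode.isDICode_decoder hK, hrate⟩
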